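/- **Setting.** Let $\tau\in C([0,1])\cap C^1((0,1])$ be real-valued with $\tau(0)=0$, $\tau>0$ on $(0,1]$, $$m_\tau:=\sup_{0<x\le 1}\frac{x|\tau'(x)|}{\tau(x)}<2,\qquad \tau\in C^{[m_\tau]}([0,1]),$$ where $[\cdot]$ is the integer part. Let $0<\tilde\alpha<1$, $\wp\ge 0$, $\rho>0$, and put $\zeta=\rho\,\pi^{-1}\sin(\tilde\alpha\pi)$ and $\eta(\xi)=|\xi|^{(2\tilde\alpha-1)/2}$ for $\xi\in\mathbb R$. Let $$H^1_\tau(0,1)=\{\psi\in L^2(0,1):\ \psi\text{ locally absolutely continuous in }(0,1],\ \sqrt{\tau}\,\psi_x\in L^2(0,1)\},$$ $$H^2_\tau(0,1)=\{\psi\in H^1_\tau(0,1):\ \tau\psi_x\in H^1(0,1)\},$$ and let $W^1_\tau(0,1)=\{\psi\in H^1_\tau(0,1):\psi(0)=0\}$ if $m_\tau<1$ (with $\psi(0)=\lim_{x\to0^+}\psi(x)$), and $W^1_\tau(0,1)=H^1_\tau(0,1)$ if $1\le m_\tau<2$. Let $\mathcal H=L^2(0,1)\times L^2(\mathbb R)$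 (complex-valued functions) with the inner product $$\langle(\psi,\vartheta),(\tilde\psi,\tilde\vartheta)\rangle_{\mathcal H}=\int_0^1\psi\,\overline{\tilde\psi}\,dx+\zeta\int_{\mathbb R}\vartheta\,\overline{\tilde\vartheta}\,d\xi ,$$ and let $\mathcal A$ be the operator in $\mathcal H$ $$\mathcal A(\psi,\vartheta)=\bigl(i(\tau\psi_x)_x,\ -(\xi^2+\wp)\vartheta+\eta(\xi)\psi(1)\bigr)$$ whose domain $D(\mathcal A)$ consists of all $(\psi,\vartheta)\in\mathcal H$ with $\psi\in H^2_\tau(0,1)\cap W^1_\tau(0,1)$, $(\tau\psi_x)(1)=i\zeta\int_{\mathbb R}\eta\vartheta\,d\xi$, $-(\xi^2+\wp)\vartheta+\eta\psi(1)\in L^2(\mathbb R)$ and $|\xi|\vartheta\in L^2(\mathbb R)$. Equip $D(\mathcal A)$ with the graph norm. A (mild) solution of $$U_t=\mathcal AU,\quad U(0)=U_0\qquad(\ast)$$ is a function $U\in C^0(\mathbb R_+,\mathcal H)$, $\mathbb R_+=[0,\infty)$, such that for every $t\ge0$, $\int_0^tU(s)\,ds\in D(\mathcal A)$ and $U(t)=U_0+\mathcal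 A\int_0^tU(s)\,ds$. **Theorem.** For every $U_0\in\mathcal H$ the problem $(\ast)$ has a unique solution $U\in C^0(\mathbb R_+,\mathcal H)$. Moreover, if $U_0\in D(\mathcal A)$, then $U\in C^0(\mathbb R_+,D(\mathcal A))\cap C^1(\mathbb R_+,\mathcal H)$, and $U_t(t)=\mathcal AU(t)$ for all $t\ge0$, $U(0)=U_0$. -/

import Mathlib

open Set Filter Topology MeasureTheory
open scoped ENNReal

noncomputable section

namespace DegSchrodinger

/-! ### The degenerate coefficient and the parameters -/

/-- `m_τ = sup_{0 < x ≤ 1} x |τ'(x)| / τ(x)`, as an extended nonnegative real (so that an infinite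
supremum is not lost). The derivative at `x = 1` is the one-sided one. -/
def degIndex (τ : ℝ → ℝ) : ℝ≥0∞ :=
  ⨆ x ∈ Ioc (0 : ℝ) 1, ENNReal.ofReal (x * |derivWithin τ (Ioc 0 1) x| / τ x)

/-- The data of the problem: the coefficient `τ`, the order `α ∈ (0,1)` and the exponential
weight `wp ≥ 0` of the fractional damping, and the gain `ρ > 0`. -/
structure Data where
  τ : ℝ → ℝ
  α : ℝ
  wp : ℝ
  ρ : ℝ
  continuousOn_τ : ContinuousOn τ (Icc 0 1)
  contDiffOn_τ : ContDiffOn ℝ 1 τ (Ioc 0 1)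
  τ_pos : ∀ x ∈ Ioc (0 : ℝ) 1, 0 < τ x
  τ_zero : τ 0 = 0
  degIndex_lt_two : degIndex τ < 2
  /-- `τ ∈ C^{[m_τ]}([0,1])`, with `[.]` the integer part. -/
  contDiffOn_floor : ContDiffOn ℝ (⌊(degIndex τ).toReal⌋₊ : ℕ) τ (Icc 0 1)
  α_pos : 0 < α
  α_lt_one : α < 1
  wp_nonneg : 0 ≤ wp
  ρ_pos : 0 < ρ

/-! ### Weighted Sobolev spaces on `(0,1)`

Elements are described by their (locally) absolutely continuous representatives `f : ℝ → ℂ`;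
only the values of `f` on `(0,1]` (or `[0,1]`) matter. -/

/-- Lebesgue measure on `(0,1)`. -/
abbrev volI : Measure ℝ := volume.restrict (Ioo 0 1)

/-- `f` is locally absolutely continuous on `(0,1]`. -/
def LocAC (f : ℝ → ℂ) : Prop :=
  ∀ δ ∈ Ioo (0 : ℝ) 1, AbsolutelyContinuousOnInterval f δ 1

/-- `v` is the absolutely continuous representative on `[0,1]` of an element of `H¹(0,1)`. -/
def MemH1 (v : ℝ → ℂ) : Prop :=
  AbsolutelyContinuousOnInterval v 0 1 ∧ MemLp (deriv v) 2 volI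

/-- `f ∈ H¹_τ(0,1)`. -/
def MemH1τ (τ : ℝ → ℝ) (f : ℝ → ℂ) : Prop :=
  MemLp f 2 volI ∧ LocAC f ∧ MemLp (fun x => (√(τ x) : ℂ) * deriv f x) 2 volI

/-- `f ∈ W¹_τ(0,1)`: this is `H¹_τ` with the condition `f(0) = 0` (as a limit from the right)
if `m_τ < 1`, and `H¹_τ` if `1 ≤ m_τ`. -/
def MemW1 (τ : ℝ → ℝ) (f : ℝ → ℂ) : Prop :=
  MemH1τ τ f ∧ (degIndex τ < 1 → Tendsto f (𝓝[>] 0) (𝓝 0))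

/-- `f ∈ H²_τ(0,1)`, where `v` is the absolutely continuous representative of
`τ f' ∈ H¹(0,1)`; in particular `v 1` is the trace `(τ f')(1)` and `deriv v` is `(τ f')'`. -/
def MemH2τ (τ : ℝ → ℝ) (f v : ℝ → ℂ) : Prop :=
  MemH1τ τ f ∧ MemH1 v ∧ v =ᵐ[volI] fun x => (τ x : ℂ) * deriv f x

/-! ### The state space -/

namespace Data

variable (P : Data)

/-- `ζ = ρ π⁻¹ sin(α π)`. -/
def ζ : ℝ := P.ρ * Real.pi⁻¹ * Real.sin (P.α * Real.pi)

/-- `η(ξ) = |ξ|^{(2α-1)/2}`. -/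
def η (ξ : ℝ) : ℝ := |ξ| ^ ((2 * P.α - 1) / 2)

lemma ζ_pos : 0 < P.ζ := by
  have h := Real.sin_pos_of_pos_of_lt_pi (mul_pos P.α_pos Real.pi_pos)
    (by nlinarith [P.α_lt_one, Real.pi_pos])
  have := P.ρ_pos
  have := Real.pi_pos
  unfold ζ
  positivity

/-- The measure `ζ dξ` on `ℝ`. -/
abbrev volζ : Measure ℝ := ENNReal.ofReal P.ζ • (volume : Measure ℝ)

/-- The state space `ℋ = L²(0,1) × L²(ℝ)`. The second factor is formed with the measure `ζ dξ`
(the functions are those of `L²(ℝ)`), so that the Hilbert space structure is the one given by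
`⟨U, V⟩ = ∫₀¹ ψ_U conj ψ_V dx + ζ ∫ ϑ_U conj ϑ_V dξ`, see `inner_eq`. -/
abbrev H : Type := WithLp 2 (Lp ℂ 2 volI × Lp ℂ 2 P.volζ)

variable {P} in
/-- The component `ψ ∈ L²(0,1)` of a state (a representative). -/
abbrev psi (U : P.H) : ℝ → ℂ := U.fst

variable {P} in
/-- The component `ϑ ∈ L²(ℝ)` of a state (a representative). -/
abbrev theta (U : P.H) : ℝ → ℂ := U.snd

/-- Mathlib's inner products are conjugate-linear in the first variable, so `inner ℂ V U` is the
`⟨U, V⟩` above. -/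
lemma inner_eq (U V : P.H) :
    inner ℂ V U = (∫ x in Ioo (0 : ℝ) 1, psi U x * starRingEnd ℂ (psi V x)) +
      (P.ζ : ℂ) * ∫ ξ, theta U ξ * starRingEnd ℂ (theta V ξ) := by
  rw [WithLp.prod_inner_apply, L2.inner_def, L2.inner_def]
  simp [RCLike.inner_apply, integral_smul_measure, P.ζ_pos.le]

lemma ae_of_ae_volζ {p : ℝ → Prop} (h : ∀ᵐ ξ ∂P.volζ, p ξ) : ∀ᵐ ξ, p ξ :=
  (Measure.ae_ennreal_smul_measure_iff (by simpa using P.ζ_pos)).1 h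

lemma ae_volζ_of_ae {p : ℝ → Prop} (h : ∀ᵐ ξ, p ξ) : ∀ᵐ ξ ∂P.volζ, p ξ :=
  (Measure.ae_ennreal_smul_measure_iff (by simpa using P.ζ_pos)).2 h

/-! ### The operator `𝒜` -/

variable {P} in
/-- `U = (ψ, ϑ)` belongs to the domain `D(𝒜)`, where `f` is the locally absolutely continuous
representative of `ψ` on `(0,1]` and `v` is the absolutely continuous representative of `τ ψ_x`
on `[0,1]`:
`ψ ∈ H²_τ ∩ W¹_τ`, `(τ ψ_x)(1) = i ζ ∫ η ϑ dξ`, `-(ξ² + wp) ϑ + η ψ(1) ∈ L²(ℝ)` and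
`|ξ| ϑ ∈ L²(ℝ)`. (The integrability of `η ϑ` follows from `ϑ, |ξ| ϑ ∈ L²`; it is recorded so that
the integral visibly has its usual meaning.) -/
structure DomainRep (U : P.H) (f v : ℝ → ℂ) : Prop where
  psi_eq : psi U =ᵐ[volI] f
  memH2 : MemH2τ P.τ f v
  memW1 : MemW1 P.τ f
  integrable : Integrable (fun ξ => (P.η ξ : ℂ) * theta U ξ)
  boundary : v 1 = Complex.I * (P.ζ : ℂ) * ∫ ξ, (P.η ξ : ℂ) * theta U ξ
  memLp_second :
    MemLp (fun ξ => -((ξ ^ 2 + P.wp : ℝ) : ℂ) * theta U ξ + (P.η ξ : ℂ) * f 1) 2 volume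
  memLp_mul : MemLp (fun ξ => ((|ξ| : ℝ) : ℂ) * theta U ξ) 2 volume

variable {P} in
/-- `U = (ψ, ϑ) ∈ D(𝒜)` and `F = 𝒜 U = (i (τ ψ_x)_x, -(ξ² + wp) ϑ + η ψ(1))`. -/
def IsGen (U F : P.H) : Prop :=
  ∃ f v : ℝ → ℂ, DomainRep U f v ∧
    (psi F =ᵐ[volI] fun x => Complex.I * deriv v x) ∧
    (theta F =ᵐ[volume] fun ξ => -((ξ ^ 2 + P.wp : ℝ) : ℂ) * theta U ξ + (P.η ξ : ℂ) * f 1)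

end Data

/-! ### Linearity and single-valuedness -/

lemma LocAC.continuousOn {f : ℝ → ℂ} (h : LocAC f) : ContinuousOn f (Ioc 0 1) := by
  intro x hx
  have h2 : x / 2 ∈ Ioo (0 : ℝ) 1 := ⟨by linarith [hx.1], by linarith [hx.1, hx.2]⟩
  have := (h _ h2).continuousOn
  rw [uIcc_of_le h2.2.le] at this
  refine (this x ⟨by linarith [hx.1], hx.2⟩).mono_of_mem_nhdsWithin ?_
  have h3 : Ioi (x / 2) ∈ 𝓝 x := Ioi_mem_nhds (by linarith [hx.1])
  filter_upwards [mem_nhdsWithin_of_mem_nhds h3, self_mem_nhdsWithin] with y hy hy'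
  exact ⟨le_of_lt hy, hy'.2⟩

lemma LocAC.ae_differentiableAt {f : ℝ → ℂ} (h : LocAC f) :
    ∀ᵐ x ∂volI, DifferentiableAt ℝ f x := by
  have hn : ∀ n : ℕ, ∀ᵐ x, x ∈ uIcc (1 / ((n : ℝ) + 2)) 1 → DifferentiableAt ℝ f x := by
    intro n
    have h1 : 1 / ((n : ℝ) + 2) ∈ Ioo (0 : ℝ) 1 :=
      ⟨by positivity, by rw [div_lt_one (by positivity)]; linarith [n.cast_nonneg (α := ℝ)]⟩
    exact (h _ h1).boundedVariationOn.ae_differentiableAt_of_mem_uIcc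
  rw [ae_restrict_iff' measurableSet_Ioo]
  filter_upwards [ae_all_iff.2 hn] with x hx hx01
  obtain ⟨n, hn⟩ := exists_nat_one_div_lt hx01.1
  refine hx n ?_
  have h2 : 1 / ((n : ℝ) + 2) ≤ 1 / ((n : ℝ) + 1) := by gcongr; norm_num
  rw [mem_uIcc]
  exact Or.inl ⟨by linarith, hx01.2.le⟩

lemma LocAC.eqOn_zero {f : ℝ → ℂ} (h : LocAC f) (h0 : f =ᵐ[volI] 0) : EqOn f 0 (Ioc 0 1) := by
  rw [volI, restrict_Ioo_eq_restrict_Ioc] at h0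
  refine Measure.eqOn_of_ae_eq h0 h.continuousOn continuousOn_const ?_
  rw [interior_Ioc, closure_Ioo zero_ne_one]
  exact Ioc_subset_Icc_self

lemma MemH1.locAC {v : ℝ → ℂ} (h : MemH1 v) : LocAC v := fun δ hδ =>
  h.1.mono (by rw [uIcc_of_le hδ.2.le, uIcc_of_le zero_le_one]; exact Icc_subset_Icc_left hδ.1.le)

lemma LocAC.add {f g : ℝ → ℂ} (hf : LocAC f) (hg : LocAC g) : LocAC (f + g) :=
  fun δ hδ => (hf δ hδ).add (hg δ hδ)

lemma LocAC.smul {f : ℝ → ℂ} (c : ℂ) (hf : LocAC f) : LocAC (c • f) :=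
  fun δ hδ => (hf δ hδ).const_smul c

lemma LocAC.deriv_add {f g : ℝ → ℂ} (hf : LocAC f) (hg : LocAC g) :
    deriv (f + g) =ᵐ[volI] deriv f + deriv g := by
  filter_upwards [hf.ae_differentiableAt, hg.ae_differentiableAt] with x h1 h2
  exact _root_.deriv_add h1 h2

lemma LocAC.deriv_smul {f : ℝ → ℂ} (c : ℂ) (hf : LocAC f) :
    deriv (c • f) =ᵐ[volI] c • deriv f := by
  filter_upwards [hf.ae_differentiableAt] with x h1
  exact deriv_const_smul c h1

lemma MemH1.add {v w : ℝ → ℂ} (hv : MemH1 v) (hw : MemH1 w) : MemH1 (v + w) :=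
  ⟨hv.1.add hw.1, (hv.2.add hw.2).ae_eq (hv.locAC.deriv_add hw.locAC).symm⟩

lemma MemH1.smul {v : ℝ → ℂ} (c : ℂ) (hv : MemH1 v) : MemH1 (c • v) :=
  ⟨hv.1.const_smul c, (hv.2.const_smul c).ae_eq (hv.locAC.deriv_smul c).symm⟩

lemma MemH1τ.add {τ : ℝ → ℝ} {f g : ℝ → ℂ} (hf : MemH1τ τ f) (hg : MemH1τ τ g) :
    MemH1τ τ (f + g) := by
  refine ⟨hf.1.add hg.1, hf.2.1.add hg.2.1, (hf.2.2.add hg.2.2).ae_eq ?_⟩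
  filter_upwards [hf.2.1.deriv_add hg.2.1] with x hx
  simp [hx, mul_add]

lemma MemH1τ.smul {τ : ℝ → ℝ} {f : ℝ → ℂ} (c : ℂ) (hf : MemH1τ τ f) : MemH1τ τ (c • f) := by
  refine ⟨hf.1.const_smul c, hf.2.1.smul c, (hf.2.2.const_smul c).ae_eq ?_⟩
  filter_upwards [hf.2.1.deriv_smul c] with x hx
  simp [hx]; ring

lemma MemW1.add {τ : ℝ → ℝ} {f g : ℝ → ℂ} (hf : MemW1 τ f) (hg : MemW1 τ g) :
    MemW1 τ (f + g) :=
  ⟨hf.1.add hg.1, fun h => by simpa using! (hf.2 h).add (hg.2 h)⟩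

lemma MemW1.smul {τ : ℝ → ℝ} {f : ℝ → ℂ} (c : ℂ) (hf : MemW1 τ f) : MemW1 τ (c • f) :=
  ⟨hf.1.smul c, fun h => by simpa using! (hf.2 h).const_smul c⟩

lemma MemH2τ.add {τ : ℝ → ℝ} {f g v w : ℝ → ℂ} (hf : MemH2τ τ f v) (hg : MemH2τ τ g w) :
    MemH2τ τ (f + g) (v + w) := by
  refine ⟨hf.1.add hg.1, hf.2.1.add hg.2.1, ?_⟩
  filter_upwards [hf.2.2, hg.2.2, hf.1.2.1.deriv_add hg.1.2.1] with x h1 h2 h3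
  simp [h1, h2, h3, mul_add]

lemma MemH2τ.smul {τ : ℝ → ℝ} {f v : ℝ → ℂ} (c : ℂ) (hf : MemH2τ τ f v) :
    MemH2τ τ (c • f) (c • v) := by
  refine ⟨hf.1.smul c, hf.2.1.smul c, ?_⟩
  filter_upwards [hf.2.2, hf.1.2.1.deriv_smul c] with x h1 h2
  simp [h1, h2]; ring

lemma memH1_zero : MemH1 0 := by
  refine ⟨?_, ?_⟩
  · simpa [AbsolutelyContinuousOnInterval] using tendsto_const_nhds
  · have : deriv (0 : ℝ → ℂ) = 0 := by ext x; simp [Pi.zero_def]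
    rw [this]; exact MemLp.zero

lemma memH1τ_zero (τ : ℝ → ℝ) : MemH1τ τ 0 := by
  refine ⟨MemLp.zero, memH1_zero.locAC, ?_⟩
  have : (fun x => (√(τ x) : ℂ) * deriv (0 : ℝ → ℂ) x) = 0 := by ext x; simp [Pi.zero_def]
  rw [this]; exact MemLp.zero

namespace Data

variable {P : Data}

lemma theta_zero : theta (0 : P.H) =ᵐ[volume] 0 := P.ae_of_ae_volζ (Lp.coeFn_zero ℂ 2 P.volζ)

lemma theta_add (U V : P.H) : theta (U + V) =ᵐ[volume] theta U + theta V :=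
  P.ae_of_ae_volζ (Lp.coeFn_add U.snd V.snd)

lemma theta_smul (c : ℂ) (U : P.H) : theta (c • U) =ᵐ[volume] c • theta U :=
  P.ae_of_ae_volζ (Lp.coeFn_smul c U.snd)

lemma psi_add (U V : P.H) : psi (U + V) =ᵐ[volI] psi U + psi V := Lp.coeFn_add U.fst V.fst

lemma psi_smul (c : ℂ) (U : P.H) : psi (c • U) =ᵐ[volI] c • psi U := Lp.coeFn_smul c U.fst

lemma isGen_zero : IsGen (0 : P.H) 0 := by
  have hd : ∀ x, deriv (0 : ℝ → ℂ) x = 0 := by intro x; simp [Pi.zero_def]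
  have hη : (fun ξ => (P.η ξ : ℂ) * theta (0 : P.H) ξ) =ᵐ[volume] 0 := by
    filter_upwards [theta_zero (P := P)] with ξ h; simp [h]
  refine ⟨0, 0, ⟨Lp.coeFn_zero ℂ 2 volI, ⟨memH1τ_zero _, memH1_zero, ?_⟩,
    ⟨memH1τ_zero _, fun _ => tendsto_const_nhds⟩, ?_, ?_, ?_, ?_⟩, ?_, ?_⟩
  · filter_upwards with x; simp [hd]
  · exact (integrable_zero ℝ ℂ volume).congr hη.symm
  · rw [integral_congr_ae hη]; simp
  · refine (MemLp.zero (ε := ℂ)).ae_eq ?_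
    filter_upwards [theta_zero (P := P)] with ξ h; simp [h]
  · refine (MemLp.zero (ε := ℂ)).ae_eq ?_
    filter_upwards [theta_zero (P := P)] with ξ h; simp [h]
  · filter_upwards [Lp.coeFn_zero ℂ 2 volI] with x h
    simp only [hd, mul_zero]; exact h
  · filter_upwards [theta_zero (P := P)] with ξ h; simp [h]

lemma IsGen.add {U V F G : P.H} (hU : IsGen U F) (hV : IsGen V G) : IsGen (U + V) (F + G) := by
  obtain ⟨f, v, hf, h1, h2⟩ := hU
  obtain ⟨g, w, hg, h3, h4⟩ := hV
  have hη : (fun ξ => (P.η ξ : ℂ) * theta (U + V) ξ) =ᵐ[volume]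
      fun ξ => (P.η ξ : ℂ) * theta U ξ + (P.η ξ : ℂ) * theta V ξ := by
    filter_upwards [theta_add U V] with ξ h; simp [h, mul_add]
  refine ⟨f + g, v + w, ⟨?_, hf.memH2.add hg.memH2, hf.memW1.add hg.memW1, ?_, ?_, ?_, ?_⟩, ?_, ?_⟩
  · exact (psi_add U V).trans (hf.psi_eq.add hg.psi_eq)
  · exact (hf.integrable.add hg.integrable).congr hη.symm
  · rw [integral_congr_ae hη, integral_add hf.integrable hg.integrable, Pi.add_apply,
      hf.boundary, hg.boundary, mul_add]
  · refine (hf.memLp_second.add hg.memLp_second).ae_eq ?_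
    filter_upwards [theta_add U V] with ξ h
    simp [h]; ring
  · refine (hf.memLp_mul.add hg.memLp_mul).ae_eq ?_
    filter_upwards [theta_add U V] with ξ h
    simp [h]; ring
  · filter_upwards [psi_add F G, h1, h3, hf.memH2.2.1.locAC.deriv_add hg.memH2.2.1.locAC]
      with x e1 e2 e3 e4
    simp [e1, e2, e3, e4]; ring
  · filter_upwards [theta_add F G, theta_add U V, h2, h4] with ξ e1 e2 e3 e4
    simp [e1, e2, e3, e4]; ring

lemma IsGen.smul {U F : P.H} (c : ℂ) (hU : IsGen U F) : IsGen (c • U) (c • F) := by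
  obtain ⟨f, v, hf, h1, h2⟩ := hU
  have hη : (fun ξ => (P.η ξ : ℂ) * theta (c • U) ξ) =ᵐ[volume]
      fun ξ => c * ((P.η ξ : ℂ) * theta U ξ) := by
    filter_upwards [theta_smul c U] with ξ h; simp [h]; ring
  refine ⟨c • f, c • v, ⟨?_, hf.memH2.smul c, hf.memW1.smul c, ?_, ?_, ?_, ?_⟩, ?_, ?_⟩
  · exact (psi_smul c U).trans (hf.psi_eq.const_smul c)
  · exact (hf.integrable.const_mul c).congr hη.symm
  · rw [integral_congr_ae hη, integral_const_mul, Pi.smul_apply, hf.boundary, smul_eq_mul]; ring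
  · refine (hf.memLp_second.const_smul c).ae_eq ?_
    filter_upwards [theta_smul c U] with ξ h
    simp [h]; ring
  · refine (hf.memLp_mul.const_smul c).ae_eq ?_
    filter_upwards [theta_smul c U] with ξ h
    simp [h]; ring
  · filter_upwards [psi_smul c F, h1, hf.memH2.2.1.locAC.deriv_smul c] with x e1 e2 e3
    simp [e1, e2, e3]; ring
  · filter_upwards [theta_smul c F, theta_smul c U, h2] with ξ e1 e2 e3
    simp [e1, e2, e3]; ring

lemma IsGen.eq_zero {F : P.H} (h : IsGen 0 F) : F = 0 := by
  obtain ⟨f, v, hf, h1, h2⟩ := h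
  have f0 : EqOn f 0 (Ioc 0 1) := hf.memH2.1.2.1.eqOn_zero
    (hf.psi_eq.symm.trans (Lp.coeFn_zero ℂ 2 volI))
  have d0 : ∀ g : ℝ → ℂ, EqOn g 0 (Ioc 0 1) → ∀ x ∈ Ioo (0 : ℝ) 1, deriv g x = 0 := by
    intro g hg x hx
    have : g =ᶠ[𝓝 x] fun _ => 0 := by
      filter_upwards [Ioo_mem_nhds hx.1 hx.2] with y hy using hg (Ioo_subset_Ioc_self hy)
    rw [this.deriv_eq]; simp
  have v0 : EqOn v 0 (Ioc 0 1) := by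
    refine hf.memH2.2.1.locAC.eqOn_zero ?_
    filter_upwards [hf.memH2.2.2, ae_restrict_mem measurableSet_Ioo] with x h1 h2
    simp [h1, d0 f f0 x h2]
  have e1 : F.fst = 0 := by
    refine (Lp.eq_zero_iff_ae_eq_zero).2 ?_
    filter_upwards [h1, ae_restrict_mem measurableSet_Ioo] with x e1 e2
    simpa [d0 v v0 x e2] using e1
  have e2 : F.snd = 0 := by
    refine (Lp.eq_zero_iff_ae_eq_zero).2 (P.ae_volζ_of_ae ?_)
    filter_upwards [h2, theta_zero (P := P)] with ξ e1 e2
    have : f 1 = 0 := f0 (by simp)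
    simpa [e2, this] using e1
  exact (WithLp.ofLp_injective 2) (Prod.ext e1 e2)

variable (P) in
/-- The graph `{(U, 𝒜 U) : U ∈ D(𝒜)}`. -/
def genGraph : Submodule ℂ (P.H × P.H) where
  carrier := {p | IsGen p.1 p.2}
  zero_mem' := isGen_zero
  add_mem' := IsGen.add
  smul_mem' := fun c _ h => IsGen.smul c h

variable (P) in
/-- The operator `𝒜 : D(𝒜) ⊆ ℋ → ℋ`, the linear operator with graph `genGraph`. -/
def A : P.H →ₗ.[ℂ] P.H := P.genGraph.toLinearPMap

lemma mem_graph_A {U F : P.H} : (U, F) ∈ P.A.graph ↔ IsGen U F := by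
  rw [A, Submodule.toLinearPMap_graph_eq]
  · rfl
  · rintro ⟨U, F⟩ h (rfl : U = 0)
    exact IsGen.eq_zero h

lemma mem_domain_A {U : P.H} : U ∈ P.A.domain ↔ ∃ f v : ℝ → ℂ, DomainRep U f v := by
  rw [LinearPMap.mem_domain_iff]
  simp_rw [mem_graph_A]
  constructor
  · rintro ⟨F, f, v, h, -⟩
    exact ⟨f, v, h⟩
  · rintro ⟨f, v, h⟩
    have h1 : MemLp (fun x => Complex.I * deriv v x) 2 volI := h.memH2.2.1.2.const_mul _
    have h2 := h.memLp_second.smul_measure (c := ENNReal.ofReal P.ζ) ENNReal.ofReal_ne_top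
    exact ⟨WithLp.toLp 2 (h1.toLp _, h2.toLp _), f, v, h, h1.coeFn_toLp,
      P.ae_of_ae_volζ h2.coeFn_toLp⟩

end Data

/-! ### Solutions of the abstract problem `U_t = A U`, `U(0) = U₀` on `[0, ∞)` -/

section Cauchy

variable {E : Type*} [NormedAddCommGroup E] [NormedSpace ℂ E]

/-- `u ∈ C⁰(ℝ₊, E)` is a (mild) solution of `u_t = A u`, `u(0) = u₀`: for all `t ≥ 0`,
`∫₀ᵗ u ds ∈ D(A)` and `u(t) = u₀ + A ∫₀ᵗ u ds`. -/
def IsMildSolution (A : E →ₗ.[ℂ] E) (u₀ : E) (u : ℝ → E) : Prop :=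
  ContinuousOn u (Ici 0) ∧
    ∀ t, 0 ≤ t → ∃ h : (∫ s in (0 : ℝ)..t, u s) ∈ A.domain, u t = u₀ + A ⟨∫ s in (0 : ℝ)..t, u s, h⟩

/-- `u ∈ C⁰(ℝ₊, D(A))`, where `D(A)` carries the graph norm: `u` takes values in `D(A)`, and
`t ↦ (u t, A (u t))` is continuous. -/
def ContinuousInDomain (A : E →ₗ.[ℂ] E) (u : ℝ → E) : Prop :=
  ∃ h : ∀ t : Ici (0 : ℝ), u t ∈ A.domain,
    Continuous fun t : Ici (0 : ℝ) => (u t, A ⟨u t, h t⟩)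

/-- `u ∈ C¹(ℝ₊, E)`. -/
def C1OnHalfLine (u : ℝ → E) : Prop := ContDiffOn ℝ 1 u (Ici 0)

/-- `u` satisfies `u(0) = u₀`, `u t ∈ D(A)` and `u_t(t) = A (u t)` for all `t ≥ 0`
(with the one-sided derivative at `0`). -/
def SolvesPointwise (A : E →ₗ.[ℂ] E) (u₀ : E) (u : ℝ → E) : Prop :=
  u 0 = u₀ ∧ ∀ t, 0 ≤ t → ∃ h : u t ∈ A.domain, HasDerivWithinAt u (A ⟨u t, h⟩) (Ici 0) t

end Cauchy

end DegSchrodinger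

end

namespace DegSchrodinger

section Abstract

variable {E : Type*} [NormedAddCommGroup E] [InnerProductSpace ℂ E]

/-! ### Accretive and dissipative operators in a Hilbert space -/

/-! The proof is the Lumer–Phillips theorem: `𝒜` is dissipative and `1 - 𝒜` is onto, so `𝒜`
generates a contraction semigroup.

Dissipativity is an energy identity (`Data.IsGen.re_inner_nonpos`): integration by parts and the
condition at `x = 1` make all coupling terms purely imaginary and leave `-ζ ∫ (ξ² + wp) |ϑ|²`. The
delicate point is that the boundary term `τ ψ_x conj ψ` vanishes at `0`
(`Data.tendsto_flux_mul_conj`). If `m_τ < 1` this is the condition `ψ(0) = 0`; otherwise `τ = O(x)`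
forces the flux to vanish at `0`, hence to be `O(√x)`, and a nonzero limit would make `|ψ|²` at
least a multiple of `1/x`.

For surjectivity, no variational problem is solved. With `Q` the projection onto the `ψ` component,
the equation `(1 - Q - 𝒜) U = F` is explicit: `ϑ` is found by division, `τ ψ_x` and then `ψ` by
integration, and the conditions at the endpoints reduce to scalar linear equations
(`Data.exists_isGen_sub_projPsi`). Since `1 - Q - 𝒜` is accretive, `exists_apply_add_projection_eq`
restores `Q`.

The abstract part builds the semigroup from `K = (1 - A)⁻¹` alone, by Yosida approximation
(`FirmlyNonexpansive.exists_semigroup`), and `wellPosed_of_maximal_dissipative` translates it into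
mild and classical solutions. Density of the domain is a consequence, not an assumption. -/

lemma accretive_ker_eq_zero {D : Submodule ℂ E} (T : D →ₗ[ℂ] E)
    (hacc : ∀ x : D, 0 ≤ (inner ℂ (T x) (x : E)).re) (hsurj : Function.Surjective T)
    {x : D} (hx : T x = 0) : x = 0 := by
  obtain ⟨y, hy⟩ := hsurj (-(x : E))
  by_contra hne
  have hpos : 0 < ‖(x : E)‖ ^ 2 := by
    have : (x : E) ≠ 0 := by simpa using hne
    positivity
  set c : ℝ := (inner ℂ (x : E) (y : E)).re
  -- Accretivity at `y + s x`, where `T y = -x`, reads `-c - s ‖x‖² ≥ 0`; this `s` turns the left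
  -- side into `-c - |c| - 1 < 0`.
  set s : ℝ := (|c| + 1) / ‖(x : E)‖ ^ 2
  have h := hacc (y + (s : ℂ) • x)
  rw [map_add, map_smul, hx, smul_zero, add_zero, hy] at h
  have e : (inner ℂ (-(x : E)) ((y + (s : ℂ) • x : D) : E)).re = -c - s * ‖(x : E)‖ ^ 2 := by
    rw [Submodule.coe_add, Submodule.coe_smul, inner_neg_left, inner_add_right, inner_smul_right,
      inner_self_eq_norm_sq_to_K]
    simp only [Complex.neg_re, Complex.add_re, Complex.coe_algebraMap, ← Complex.ofReal_pow,
      Complex.re_ofReal_mul, Complex.ofReal_re, c]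
    ring
  rw [e, div_mul_cancel₀ _ hpos.ne'] at h
  linarith [neg_abs_le c]

/-- A surjective accretive operator has a bounded everywhere defined inverse. -/
theorem exists_bounded_inverse [CompleteSpace E] {D : Submodule ℂ E} (T : D →ₗ[ℂ] E)
    (hacc : ∀ x : D, 0 ≤ (inner ℂ (T x) (x : E)).re) (hsurj : Function.Surjective T) :
    ∃ K : E →L[ℂ] E, (∀ y, ∃ h : K y ∈ D, T ⟨K y, h⟩ = y) ∧ ∀ x : D, K (T x) = x := by
  have hinj : Function.Injective T := by
    rw [injective_iff_map_eq_zero]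
    exact fun x hx => accretive_ker_eq_zero T hacc hsurj hx
  let e := LinearEquiv.ofBijective T ⟨hinj, hsurj⟩
  let k : E →ₗ[ℂ] E := D.subtype ∘ₗ e.symm.toLinearMap
  have hk : ∀ y, 0 ≤ (inner ℂ y (k y)).re := by
    intro y
    have := hacc (e.symm y)
    rwa [show T (e.symm y) = y from e.apply_symm_apply y] at this
  have hcont : Continuous k := by
    refine LinearMap.continuous_of_seq_closed_graph k fun u x y hu hku => ?_
    rw [← sub_eq_zero]
    set z := y - k x with hz
    -- Minty's trick for the closed graph: test the monotonicity of `k` between `u n` and `x + s z`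
    -- and pass to the limit. For small `s > 0` the linear term dominates and forces `z = 0`.
    have key : ∀ s : ℝ, 0 ≤ -(s * ‖z‖ ^ 2) + s ^ 2 * (inner ℂ z (k z)).re := by
      intro s
      have h1 : Tendsto (fun n => (inner ℂ (u n - x - (s : ℂ) • z)
          (k (u n) - k x - (s : ℂ) • k z)).re) atTop
          (𝓝 (inner ℂ (x - x - (s : ℂ) • z) (y - k x - (s : ℂ) • k z)).re) :=
        (Complex.continuous_re.tendsto _).comp
          (Filter.Tendsto.inner ((hu.sub_const _).sub_const _) ((hku.sub_const _).sub_const _))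
      have h2 := ge_of_tendsto' h1 fun n => by
        have := hk (u n - x - (s : ℂ) • z)
        rwa [map_sub, map_sub, map_smul] at this
      have e1 : (inner ℂ (x - x - (s : ℂ) • z) (y - k x - (s : ℂ) • k z)).re =
          -(s * ‖z‖ ^ 2) + s ^ 2 * (inner ℂ z (k z)).re := by
        rw [← hz, sub_self, zero_sub, inner_neg_left, inner_smul_left, inner_sub_right,
          inner_smul_right, inner_self_eq_norm_sq_to_K]
        simp only [Complex.conj_ofReal, Complex.neg_re, Complex.re_ofReal_mul, Complex.sub_re,
          Complex.coe_algebraMap, ← Complex.ofReal_pow, Complex.ofReal_re]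
        ring
      rwa [e1] at h2
    by_contra hne
    have hpos : 0 < ‖z‖ ^ 2 := by positivity
    set c := (inner ℂ z (k z)).re
    have hs := key (‖z‖ ^ 2 / (|c| + 1))
    have hc : 0 < |c| + 1 := by positivity
    have : -(‖z‖ ^ 2 / (|c| + 1) * ‖z‖ ^ 2) + (‖z‖ ^ 2 / (|c| + 1)) ^ 2 * c =
        (‖z‖ ^ 2 / (|c| + 1)) ^ 2 * (c - (|c| + 1)) := by
      field_simp; ring
    rw [this] at hs
    have h3 : 0 < (‖z‖ ^ 2 / (|c| + 1)) ^ 2 := by positivity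
    nlinarith [le_abs_self c]
  refine ⟨⟨k, hcont⟩, fun y => ⟨(e.symm y).2, ?_⟩, fun x => ?_⟩
  · exact e.apply_symm_apply y
  · exact congrArg Subtype.val (e.symm_apply_apply x)

/-- A bounded operator `1 + S` with `S` accretive is invertible. -/
lemma isUnit_one_add_of_accretive [CompleteSpace E] (S : E →L[ℂ] E)
    (hS : ∀ x, 0 ≤ (inner ℂ (S x) x).re) : IsUnit (1 + S) := by
  refine ContinuousLinearMap.isUnit_of_forall_le_norm_inner_map (1 + S) one_pos fun x => ?_
  refine le_trans ?_ (Complex.re_le_norm _)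
  rw [add_apply, inner_add_left, Complex.add_re,
    one_apply_eq_self, inner_self_eq_norm_sq_to_K]
  have := hS x
  simp only [Complex.coe_algebraMap, ← Complex.ofReal_pow, Complex.ofReal_re]
  simpa using this

/-- If `T` is accretive and surjective, and `Q` is an orthogonal projection, then `T + Q` is
surjective. -/
theorem exists_apply_add_projection_eq [CompleteSpace E] {D : Submodule ℂ E} (T : D →ₗ[ℂ] E)
    (hacc : ∀ x : D, 0 ≤ (inner ℂ (T x) (x : E)).re) (hsurj : Function.Surjective T)
    (Q : E →L[ℂ] E) (hQQ : ∀ x, Q (Q x) = Q x) (hQ : ∀ x y, inner ℂ (Q x) y = inner ℂ x (Q y))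
    (F : E) : ∃ x : D, T x + Q x = F := by
  obtain ⟨K, hK, -⟩ := exists_bounded_inverse T hacc hsurj
  -- Look for the solution as `K (z + F - Q F)` with `z` in the range of `Q`: the equation becomes
  -- `z + Q K z = Q F - Q K (F - Q F)`. On that range `Q K = Q K Q`, which is accretive because `Re
  -- ⟨Q K Q x, x⟩ = Re ⟨K Q x, Q x⟩`.
  have hu : IsUnit (1 + Q * K * Q) := by
    refine isUnit_one_add_of_accretive _ fun x => ?_
    simp only [mul_apply_eq_comp, hQ]
    obtain ⟨h, h'⟩ := hK (Q x)
    have := hacc ⟨_, h⟩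
    rw [h'] at this
    rwa [← inner_conj_symm, Complex.conj_re]
  obtain ⟨z, hz⟩ := ((ContinuousLinearMap.isUnit_iff_bijective).1 hu).2
    (Q F - Q (K (F - Q F)))
  simp only [add_apply, one_apply_eq_self,
    mul_apply_eq_comp] at hz
  have hz' : z = Q F - Q (K (F - Q F)) - Q (K (Q z)) := eq_sub_of_add_eq hz
  have hQz : Q z = z := by
    rw [hz']
    simp only [map_sub, hQQ]
  obtain ⟨h, h'⟩ := hK (z + (F - Q F))
  refine ⟨⟨_, h⟩, ?_⟩
  rw [h']
  change _ + Q (K (z + (F - Q F))) = F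
  rw [map_add K, map_add Q]
  rw [hQz] at hz
  rw [show z + (F - Q F) + (Q (K z) + Q (K (F - Q F))) =
    (z + Q (K z)) + (F - Q F) + Q (K (F - Q F)) by abel, hz]
  abel

end Abstract

section Yosida

variable {E : Type*} [NormedAddCommGroup E] [InnerProductSpace ℂ E]

/-! ### Contraction semigroups generated through the resolvent

Below `K` stands for the resolvent `(1 - A)⁻¹` of a dissipative operator `A`. -/

/-- `‖K y‖² ≤ Re ⟨K y, y⟩`, which characterizes the resolvents at `1` of dissipative operators. -/
def FirmlyNonexpansive (K : E →L[ℂ] E) : Prop :=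
  ∀ y, ‖K y‖ ^ 2 ≤ (inner ℂ (K y) y).re

variable {K : E →L[ℂ] E}

lemma FirmlyNonexpansive.norm_apply_le (hK : FirmlyNonexpansive K) (y : E) : ‖K y‖ ≤ ‖y‖ := by
  have h1 := (hK y).trans (re_inner_le_norm (𝕜 := ℂ) (K y) y)
  by_contra! h
  nlinarith [norm_nonneg y]

variable (K) in
/-- `(n + 1) (n + 1 - A)⁻¹`. -/
noncomputable def scaledResolvent (n : ℕ) : E →L[ℂ] E :=
  -- From `n + 1 - A = (1 + n K) K⁻¹` on the domain: only the bounded operator `K` is needed.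
  ((n : ℂ) + 1) • (K * Ring.inverse (1 + (n : ℂ) • K))

variable (K) in
/-- The Yosida approximation of `A`. -/
noncomputable def yosida (n : ℕ) : E →L[ℂ] E := ((n : ℂ) + 1) • (scaledResolvent K n - 1)

lemma commute_ringInverse_right {R : Type*} [Ring R] {a b : R} (h : Commute a b) :
    Commute a (Ring.inverse b) := by
  by_cases hb : IsUnit b
  · obtain ⟨u, rfl⟩ := hb
    rw [Ring.inverse_unit]
    exact h.units_inv_right
  · rw [Ring.inverse_non_unit _ hb]
    exact Commute.zero_right a

lemma commute_scaledResolvent {L : E →L[ℂ] E} (h : Commute L K) (n : ℕ) :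
    Commute L (scaledResolvent K n) := by
  refine Commute.smul_right (h.mul_right ?_) _
  exact commute_ringInverse_right ((Commute.one_right L).add_right (h.smul_right _))

lemma commute_yosida {L : E →L[ℂ] E} (h : Commute L K) (n : ℕ) : Commute L (yosida K n) :=
  ((commute_scaledResolvent h n).sub_right (Commute.one_right L)).smul_right _

variable [CompleteSpace E]

lemma FirmlyNonexpansive.isUnit (hK : FirmlyNonexpansive K) (n : ℕ) :
    IsUnit (1 + (n : ℂ) • K) := by
  refine isUnit_one_add_of_accretive _ fun x => ?_
  have e : (inner ℂ (((n : ℂ) • K) x) x).re = n * (inner ℂ (K x) x).re := by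
    rw [smul_apply, inner_smul_left]; simp
  rw [e]
  exact mul_nonneg n.cast_nonneg ((sq_nonneg _).trans (hK x))

/-- With `y = z + n K z`, expanding the square gives `‖y‖² = ‖z‖² + 2 n Re ⟨K z, z⟩ + n² ‖K z‖²`,
and each of the first two terms is bounded below through `‖K z‖²`, for a total of `(n + 1)² ‖K z‖²`.
-/
lemma FirmlyNonexpansive.norm_scaledResolvent_apply_le (hK : FirmlyNonexpansive K) (n : ℕ)
    (y : E) : ‖scaledResolvent K n y‖ ≤ ‖y‖ := by
  set z := Ring.inverse (1 + (n : ℂ) • K) y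
  have hz : z + (n : ℂ) • K z = y := by
    have := congrArg (fun L : E →L[ℂ] E => L y) (Ring.mul_inverse_cancel _ (hK.isUnit n))
    simpa using! this
  have e : scaledResolvent K n y = ((n : ℂ) + 1) • K z := rfl
  rw [e, ← hz, norm_smul, ← sq_le_sq₀ (by positivity) (by positivity), mul_pow]
  have h1 : ‖z + (n : ℂ) • K z‖ ^ 2 =
      ‖z‖ ^ 2 + 2 * (n * (inner ℂ (K z) z).re) + n ^ 2 * ‖K z‖ ^ 2 := by
    rw [norm_add_sq (𝕜 := ℂ), inner_smul_right, norm_smul, mul_pow]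
    have h0 : (inner ℂ z (K z)).re = (inner ℂ (K z) z).re := by
      rw [← inner_conj_symm, Complex.conj_re]
    simp [h0]
  have h2 : ‖(n : ℂ) + 1‖ = (n : ℝ) + 1 := by
    rw [← Nat.cast_add_one, Complex.norm_natCast]; push_cast; rfl
  have h3 := hK z
  have h4 := hK.norm_apply_le z
  have h5 : ‖K z‖ ^ 2 ≤ ‖z‖ ^ 2 := by gcongr
  rw [h1, h2]
  have : (n : ℝ) * ‖K z‖ ^ 2 ≤ n * (inner ℂ (K z) z).re := by gcongr
  nlinarith

lemma FirmlyNonexpansive.yosida_dissipative (hK : FirmlyNonexpansive K) (n : ℕ) (y : E) :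
    (inner ℂ y (yosida K n y)).re ≤ 0 := by
  have h2 : ((n : ℂ) + 1) = ((n + 1 : ℝ) : ℂ) := by push_cast; rfl
  rw [yosida, smul_apply, sub_apply, one_apply_eq_self, inner_smul_right, inner_sub_right, h2,
    Complex.re_ofReal_mul, Complex.sub_re]
  have h1 := re_inner_le_norm (𝕜 := ℂ) y (scaledResolvent K n y)
  have h3 := hK.norm_scaledResolvent_apply_le n y
  have h4 : (inner ℂ y y).re = ‖y‖ ^ 2 := by
    rw [inner_self_eq_norm_sq_to_K]
    simp only [Complex.coe_algebraMap, ← Complex.ofReal_pow, Complex.ofReal_re]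
  rw [h4]
  refine mul_nonpos_of_nonneg_of_nonpos (by positivity) ?_
  simp only [RCLike.re_to_complex] at h1
  nlinarith [norm_nonneg y]

/-- This is `A_n = R_n A` on the domain, written without `A`: there `A K = K - 1`. -/
lemma FirmlyNonexpansive.yosida_mul (hK : FirmlyNonexpansive K) (n : ℕ) :
    yosida K n * K = scaledResolvent K n * (K - 1) := by
  have hu := Ring.inverse_mul_cancel _ (hK.isUnit n)
  set I := Ring.inverse (1 + (n : ℂ) • K) with hI
  have h1 : K * I + (n : ℂ) • (K * I * K) = K := by
    have : K * (I * (1 + (n : ℂ) • K)) = K := by rw [hu, mul_one]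
    rwa [mul_add, mul_one, mul_smul_comm, mul_add, mul_smul_comm, ← mul_assoc] at this
  rw [yosida, scaledResolvent, ← hI]
  rw [smul_mul_assoc, smul_mul_assoc, sub_mul, one_mul, mul_sub, mul_one, smul_mul_assoc]
  congr 1
  rw [add_smul, one_smul, sub_eq_sub_iff_add_eq_add, add_right_comm]
  rw [add_comm _ (K * I), h1, add_comm]

/-- On the range of `K` the error is `(n + 1)⁻¹ R_n (K z - z)`, hence `O(1/n)`; the uniform bound
`‖R_n‖ ≤ 1` extends the convergence to the closure. -/
lemma FirmlyNonexpansive.tendsto_scaledResolvent (hK : FirmlyNonexpansive K)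
    (hd : DenseRange K) (y : E) :
    Tendsto (fun n => scaledResolvent K n y) atTop (𝓝 y) := by
  have hrange : ∀ z, Tendsto (fun n => scaledResolvent K n (K z)) atTop (𝓝 (K z)) := by
    intro z
    rw [tendsto_iff_norm_sub_tendsto_zero]
    have hle : ∀ n : ℕ, ‖scaledResolvent K n (K z) - K z‖ ≤ 1 / ((n : ℝ) + 1) * ‖K z - z‖ := by
      intro n
      have h1 : yosida K n (K z) = scaledResolvent K n (K z - z) :=
        congrArg (fun L : E →L[ℂ] E => L z) (hK.yosida_mul n)
      have h2 : yosida K n (K z) = ((n : ℂ) + 1) • (scaledResolvent K n (K z) - K z) := rfl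
      have h3 : ‖(n : ℂ) + 1‖ = (n : ℝ) + 1 := by
        rw [← Nat.cast_add_one, Complex.norm_natCast]; push_cast; rfl
      have h4 := hK.norm_scaledResolvent_apply_le n (K z - z)
      rw [← h1, h2, norm_smul, h3] at h4
      rw [one_div, inv_mul_eq_div, le_div_iff₀ (by positivity), mul_comm]
      exact h4
    refine squeeze_zero (fun _ => norm_nonneg _) hle ?_
    simpa using (tendsto_one_div_add_atTop_nhds_zero_nat (𝕜 := ℝ)).mul_const ‖K z - z‖
  rw [Metric.tendsto_atTop]
  intro ε hε
  obtain ⟨z, hz⟩ := hd.exists_dist_lt y (show 0 < ε / 3 by positivity)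
  obtain ⟨N, hN⟩ := Metric.tendsto_atTop.1 (hrange z) (ε / 3) (by positivity)
  refine ⟨N, fun n hn => ?_⟩
  have h1 : dist (scaledResolvent K n y) (scaledResolvent K n (K z)) ≤ dist y (K z) := by
    rw [dist_eq_norm, dist_eq_norm, ← map_sub]
    exact hK.norm_scaledResolvent_apply_le n _
  have h2 := hN n hn
  have h3 := dist_triangle4 (scaledResolvent K n y) (scaledResolvent K n (K z)) (K z) y
  rw [dist_comm (K z) y] at h3
  linarith

lemma FirmlyNonexpansive.tendsto_yosida (hK : FirmlyNonexpansive K)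
    (hd : DenseRange K) (z : E) :
    Tendsto (fun n => yosida K n (K z)) atTop (𝓝 (K z - z)) := by
  have : ∀ n, yosida K n (K z) = scaledResolvent K n (K z - z) := fun n =>
    congrArg (fun L : E →L[ℂ] E => L z) (hK.yosida_mul n)
  simp_rw [this]
  exact hK.tendsto_scaledResolvent hd _

variable (K) in
/-- The semigroup generated by the Yosida approximation. -/
noncomputable def yosidaExp (n : ℕ) (t : ℝ) : E →L[ℂ] E := NormedSpace.exp (t • yosida K n)

lemma hasDerivAt_yosidaExp (n : ℕ) (t : ℝ) :
    HasDerivAt (yosidaExp K n) (yosidaExp K n t * yosida K n) t :=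
  hasDerivAt_exp_smul_const (yosida K n) t

lemma hasDerivAt_yosidaExp_apply (n : ℕ) (t : ℝ) (x : E) :
    HasDerivAt (fun t => yosidaExp K n t x) (yosidaExp K n t (yosida K n x)) t := by
  have h := (ContinuousLinearMap.apply ℂ E x).restrictScalars ℝ |>.hasFDerivAt.comp_hasDerivAt t
    (hasDerivAt_yosidaExp (K := K) n t)
  exact h

lemma commute_yosidaExp {L : E →L[ℂ] E} (h : Commute L K) (n : ℕ) (t : ℝ) :
    Commute L (yosidaExp K n t) :=
  Commute.exp_right ((commute_yosida h n).smul_right t)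

lemma yosidaExp_zero (n : ℕ) : yosidaExp K n 0 = 1 := by
  simp [yosidaExp, NormedSpace.exp_zero]

lemma FirmlyNonexpansive.norm_yosidaExp_apply_le (hK : FirmlyNonexpansive K) (n : ℕ) {t : ℝ}
    (ht : 0 ≤ t) (x : E) : ‖yosidaExp K n t x‖ ≤ ‖x‖ := by
  -- The derivative of `‖·‖²` needs the underlying real inner product, which is definitionally the
  -- real part of the complex one.
  let : InnerProductSpace ℝ E := InnerProductSpace.rclikeToReal ℂ E
  have hd : ∀ s, HasDerivAt (fun s => ‖yosidaExp K n s x‖ ^ 2)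
      (2 * inner ℝ (yosidaExp K n s x) (yosidaExp K n s (yosida K n x))) s := fun s =>
    (hasDerivAt_yosidaExp_apply n s x).norm_sq
  have hanti : Antitone fun s => ‖yosidaExp K n s x‖ ^ 2 := by
    refine antitone_of_deriv_nonpos (fun s => (hd s).differentiableAt) fun s => ?_
    rw [(hd s).deriv]
    have hc : yosidaExp K n s (yosida K n x) = yosida K n (yosidaExp K n s x) :=
      congrArg (fun L : E →L[ℂ] E => L x)
        (commute_yosidaExp (commute_yosida (Commute.refl K) n).symm n s).symm.eq
    have := hK.yosida_dissipative n (yosidaExp K n s x)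
    rw [hc]
    have e : inner ℝ (yosidaExp K n s x) (yosida K n (yosidaExp K n s x)) =
      (inner ℂ (yosidaExp K n s x) (yosida K n (yosidaExp K n s x))).re := rfl
    rw [e]
    linarith
  have := hanti ht
  simp only [yosidaExp_zero, one_apply_eq_self] at this
  exact (sq_le_sq₀ (norm_nonneg _) (norm_nonneg _)).1 this

/-- Interpolate along `s ↦ e^{(t-s) A_m} e^{s A_n} x`. As everything commutes, its derivative is a
product of contractions applied to `(A_n - A_m) x`. -/
lemma FirmlyNonexpansive.norm_yosidaExp_sub_le (hK : FirmlyNonexpansive K) (n m : ℕ) {t : ℝ}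
    (ht : 0 ≤ t) (x : E) :
    ‖yosidaExp K n t x - yosidaExp K m t x‖ ≤ t * ‖yosida K n x - yosida K m x‖ := by
  set f : ℝ → E := fun s => (yosidaExp K m (t - s) * yosidaExp K n s) x with hf
  have hd : ∀ s, HasDerivAt f
      ((yosidaExp K m (t - s) * yosidaExp K n s) (yosida K n x - yosida K m x)) s := by
    intro s
    have h1 : HasDerivAt (fun s => yosidaExp K m (t - s))
        (-(yosidaExp K m (t - s) * yosida K m)) s := by
      simpa using! (hasDerivAt_yosidaExp (K := K) m (t - s)).scomp s
        ((hasDerivAt_const s t).sub (hasDerivAt_id s))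
    have h2 := h1.mul (hasDerivAt_yosidaExp (K := K) n s)
    have h3 := (ContinuousLinearMap.apply ℂ E x).restrictScalars ℝ |>.hasFDerivAt.comp_hasDerivAt s
      h2
    refine h3.congr_deriv ?_
    have hc : yosida K m * yosidaExp K n s = yosidaExp K n s * yosida K m :=
      (commute_yosidaExp (commute_yosida (Commute.refl K) m).symm n s).eq
    have : -(yosidaExp K m (t - s) * yosida K m) * yosidaExp K n s +
        yosidaExp K m (t - s) * (yosidaExp K n s * yosida K n) =
        (yosidaExp K m (t - s) * yosidaExp K n s) * (yosida K n - yosida K m) := by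
      rw [mul_sub, neg_mul, mul_assoc, hc]
      simp only [mul_assoc]
      abel
    rw [this]
    rfl
  have hb := norm_image_sub_le_of_norm_deriv_le_segment' (f := f) (a := 0) (b := t)
    (C := ‖yosida K n x - yosida K m x‖) (fun s _ => (hd s).hasDerivWithinAt) (fun s hs => by
      rw [mul_apply_eq_comp]
      exact (hK.norm_yosidaExp_apply_le m (by linarith [hs.2]) _).trans
        (hK.norm_yosidaExp_apply_le n hs.1 _)) t ⟨ht, le_rfl⟩
  simpa [hf, yosidaExp_zero, mul_comm] using hb

/-- On the range of `K` the approximations `A_n` converge, so the previous bound is uniform for `t ≤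
T`; contractivity and density give the other vectors. -/
lemma FirmlyNonexpansive.uniformCauchySeqOn_yosidaExp (hK : FirmlyNonexpansive K)
    (hd : DenseRange K) (x : E) (T : ℝ) :
    UniformCauchySeqOn (fun n t => yosidaExp K n t x) atTop (Icc 0 T) := by
  rw [Metric.uniformCauchySeqOn_iff]
  intro ε hε
  obtain ⟨z, hz⟩ := hd.exists_dist_lt x (show 0 < ε / 3 by positivity)
  have hc := (hK.tendsto_yosida hd z).cauchySeq
  obtain ⟨N, hN⟩ := Metric.cauchySeq_iff.1 hc (ε / (3 * (|T| + 1))) (by positivity)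
  refine ⟨N, fun m hm n hn t ht => ?_⟩
  have hx : ∀ k, dist (yosidaExp K k t x) (yosidaExp K k t (K z)) < ε / 3 := by
    intro k
    refine lt_of_le_of_lt ?_ hz
    rw [dist_eq_norm, dist_eq_norm, ← map_sub]
    exact hK.norm_yosidaExp_apply_le k ht.1 _
  have h1 := hK.norm_yosidaExp_sub_le m n ht.1 (K z)
  rw [← dist_eq_norm, ← dist_eq_norm] at h1
  have h2 : t * dist (yosida K m (K z)) (yosida K n (K z)) ≤ ε / 3 := by
    have h3 : t ≤ |T| + 1 := by linarith [ht.2, le_abs_self T]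
    calc _ ≤ (|T| + 1) * (ε / (3 * (|T| + 1))) :=
          mul_le_mul h3 (hN m hm n hn).le dist_nonneg (by positivity)
      _ = ε / 3 := by field_simp
  have h4 := dist_triangle4 (yosidaExp K m t x) (yosidaExp K m t (K z)) (yosidaExp K n t (K z))
    (yosidaExp K n t x)
  have h5 := hx n
  rw [dist_comm] at h5
  linarith [hx m]

/-- The contraction semigroup with resolvent `K` at `1`. -/
theorem FirmlyNonexpansive.exists_semigroup (hK : FirmlyNonexpansive K) (hd : DenseRange K) :
    ∃ S : ℝ → E → E, (∀ x, ContinuousOn (fun t => S t x) (Ici 0)) ∧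
      (∀ x, S 0 x = x) ∧ (∀ t, 0 ≤ t → ∀ x, K (S t x) = S t (K x)) ∧
      -- The integrated equation for initial data `K z` in the domain, with `A (K z)` written as `K
      -- z - z`.
      (∀ t, 0 ≤ t → ∀ z, S t (K z) = K z + ∫ s in (0 : ℝ)..t, S s (K z - z)) ∧
      (∀ t, 0 ≤ t → ∀ x y, S t (x - y) = S t x - S t y) := by
  have hlim : ∀ t, 0 ≤ t → ∀ x, ∃ l, Tendsto (fun n => yosidaExp K n t x) atTop (𝓝 l) :=
    fun t ht x => cauchySeq_tendsto_of_complete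
      ((hK.uniformCauchySeqOn_yosidaExp hd x t).cauchySeq ⟨ht, le_rfl⟩)
  -- For `t < 0` convergence is not known and the value is a default; only `t ≥ 0` is ever used.
  let S : ℝ → E → E := fun t x => limUnder atTop fun n => yosidaExp K n t x
  have hS : ∀ t, 0 ≤ t → ∀ x, Tendsto (fun n => yosidaExp K n t x) atTop (𝓝 (S t x)) :=
    fun t ht x => tendsto_nhds_limUnder (hlim t ht x)
  have hcont : ∀ x, ContinuousOn (fun t => S t x) (Ici 0) := by
    intro x t ht
    have h1 : TendstoUniformlyOn (fun n t => yosidaExp K n t x) (fun t => S t x) atTop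
        (Icc 0 (t + 1)) :=
      (hK.uniformCauchySeqOn_yosidaExp hd x (t + 1)).tendstoUniformlyOn_of_tendsto
        fun s hs => hS s hs.1 x
    have h2 : ContinuousOn (fun t => S t x) (Icc 0 (t + 1)) :=
      h1.continuousOn (Eventually.of_forall fun n s _ =>
        (hasDerivAt_yosidaExp_apply n s x).continuousAt.continuousWithinAt).frequently
    refine (h2 t ⟨ht, by linarith⟩).mono_of_mem_nhdsWithin ?_
    filter_upwards [self_mem_nhdsWithin, mem_nhdsWithin_of_mem_nhds
      (Iio_mem_nhds (lt_add_one t))] with s hs hs'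
    exact ⟨hs, hs'.le⟩
  refine ⟨S, hcont, fun x => ?_, fun t ht x => ?_, fun t ht z => ?_, fun t ht x y => ?_⟩
  · refine tendsto_nhds_unique (hS 0 le_rfl x) ?_
    simp [yosidaExp_zero]
  · refine tendsto_nhds_unique ((K.continuous.tendsto _).comp (hS t ht x)) ?_
    refine (hS t ht (K x)).congr fun n => ?_
    exact congrArg (fun L : E →L[ℂ] E => L x) (commute_yosidaExp (Commute.refl K) n t).symm.eq
  · have hft : ∀ n, yosidaExp K n t (K z) =
        K z + ∫ s in (0 : ℝ)..t, yosidaExp K n s (yosida K n (K z)) := by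
      intro n
      rw [intervalIntegral.integral_eq_sub_of_hasDerivAt
        (fun s _ => hasDerivAt_yosidaExp_apply n s (K z))]
      · simp [yosidaExp_zero]
      · refine Continuous.intervalIntegrable ?_ _ _
        exact continuous_iff_continuousAt.2 fun s => (hasDerivAt_yosidaExp_apply n s _).continuousAt
    refine tendsto_nhds_unique (hS t ht (K z)) ?_
    simp_rw [hft]
    refine Tendsto.const_add _ ?_
    have hy := hK.tendsto_yosida hd z
    obtain ⟨C, hC⟩ := (Metric.isBounded_range_of_tendsto _ hy).exists_norm_le
    refine intervalIntegral.tendsto_integral_filter_of_dominated_convergence (fun _ => C) ?_ ?_ ?_ ?_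
    · refine Eventually.of_forall fun n => Continuous.aestronglyMeasurable ?_
      exact continuous_iff_continuousAt.2 fun s => (hasDerivAt_yosidaExp_apply n s _).continuousAt
    · refine Eventually.of_forall fun n => Eventually.of_forall fun s hs => ?_
      rw [uIoc_of_le ht] at hs
      exact (hK.norm_yosidaExp_apply_le n hs.1.le _).trans (hC _ ⟨n, rfl⟩)
    · exact intervalIntegrable_const
    · refine Eventually.of_forall fun s hs => ?_
      rw [uIoc_of_le ht] at hs
      have h1 : Tendsto (fun n => yosidaExp K n s (yosida K n (K z) - (K z - z))) atTop (𝓝 0) := by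
        rw [tendsto_zero_iff_norm_tendsto_zero]
        exact squeeze_zero (fun _ => norm_nonneg _) (fun n => hK.norm_yosidaExp_apply_le n hs.1.le _)
          (tendsto_iff_norm_sub_tendsto_zero.1 hy)
      simpa using h1.add (hS s hs.1.le (K z - z))
  · refine tendsto_nhds_unique (hS t ht (x - y)) ?_
    simpa using (hS t ht x).sub (hS t ht y)

end Yosida

section HalfLine

variable {E : Type*} [NormedAddCommGroup E]

/-! ### Well-posedness for maximal dissipative operators -/

/-- Freezing `u` at `u 0` for negative times gives a continuous function on the line, so primitives
are differentiable in the two-sided sense even at `0`. -/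
lemma continuous_comp_max {u : ℝ → E} (hu : ContinuousOn u (Ici 0)) :
    Continuous fun s => u (max s 0) :=
  hu.comp_continuous (by fun_prop) fun s => le_max_right s 0

lemma intervalIntegrable_of_Ici {u : ℝ → E} (hu : ContinuousOn u (Ici 0)) {t : ℝ} (ht : 0 ≤ t) :
    IntervalIntegrable u volume 0 t :=
  (hu.mono (by rw [uIcc_of_le ht]; exact Icc_subset_Ici_self)).intervalIntegrable

lemma integral_comp_max [NormedSpace ℝ E] (u : ℝ → E) {t : ℝ} (ht : 0 ≤ t) :
    ∫ s in (0 : ℝ)..t, u (max s 0) = ∫ s in (0 : ℝ)..t, u s := by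
  refine intervalIntegral.integral_congr fun s hs => ?_
  rw [uIcc_of_le ht] at hs
  simp only [max_eq_left hs.1]

end HalfLine

section WellPosed

variable {E : Type*} [NormedAddCommGroup E] [InnerProductSpace ℂ E] [CompleteSpace E]

/-- The difference of two mild solutions need not lie in the domain, but its primitive `Z` does, and
`Z' = A Z`, `Z 0 = 0`. Dissipativity makes `‖Z‖²` nonincreasing, so `Z = 0` and `v - u = A Z = 0`.
-/
lemma IsMildSolution.eqOn {A : E →ₗ.[ℂ] E} (hdiss : ∀ x : A.domain, (inner ℂ (x : E) (A x)).re ≤ 0)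
    {u₀ : E} {u v : ℝ → E} (hu : IsMildSolution A u₀ u) (hv : IsMildSolution A u₀ v) :
    EqOn v u (Ici 0) := by
  let : InnerProductSpace ℝ E := InnerProductSpace.rclikeToReal ℂ E
  have hwc : ContinuousOn (v - u) (Ici 0) := hv.1.sub hu.1
  set Z : ℝ → E := fun t => ∫ s in (0 : ℝ)..t, (v - u) (max s 0) with hZ
  have hmem : ∀ t, 0 ≤ t → ∃ h : Z t ∈ A.domain, A ⟨Z t, h⟩ = v t - u t := by
    intro t ht
    obtain ⟨h1, e1⟩ := hv.2 t ht
    obtain ⟨h2, e2⟩ := hu.2 t ht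
    have e : Z t = (∫ s in (0 : ℝ)..t, v s) - ∫ s in (0 : ℝ)..t, u s := by
      simp only [hZ]
      rw [integral_comp_max _ ht]
      exact intervalIntegral.integral_sub (intervalIntegrable_of_Ici hv.1 ht)
        (intervalIntegrable_of_Ici hu.1 ht)
    have h3 : Z t ∈ A.domain := by rw [e]; exact A.domain.sub_mem h1 h2
    refine ⟨h3, ?_⟩
    have : (⟨Z t, h3⟩ : A.domain) = ⟨_, h1⟩ - ⟨_, h2⟩ := Subtype.ext e
    rw [this, A.map_sub, e1, e2]
    abel
  have hd : ∀ t, HasDerivAt Z ((v - u) (max t 0)) t := fun t =>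
    (continuous_comp_max hwc).integral_hasStrictDerivAt 0 t |>.hasDerivAt
  have hd2 : ∀ t, HasDerivAt (fun t => ‖Z t‖ ^ 2) (2 * inner ℝ (Z t) ((v - u) (max t 0))) t :=
    fun t => (hd t).norm_sq
  have hanti : AntitoneOn (fun t => ‖Z t‖ ^ 2) (Ici 0) := by
    refine antitoneOn_of_deriv_nonpos (convex_Ici 0)
      (fun t _ => (hd2 t).continuousAt.continuousWithinAt)
      (fun t _ => (hd2 t).differentiableAt.differentiableWithinAt) fun t ht => ?_
    rw [interior_Ici] at ht
    obtain ⟨h, e⟩ := hmem t ht.le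
    rw [(hd2 t).deriv, max_eq_left ht.le, Pi.sub_apply, ← e]
    have := hdiss ⟨Z t, h⟩
    have e' : inner ℝ (Z t) (A ⟨Z t, h⟩) = (inner ℂ (Z t) (A ⟨Z t, h⟩)).re := rfl
    rw [e']
    simp only at this
    linarith
  intro t ht
  have h0 : ‖Z t‖ ^ 2 ≤ ‖Z 0‖ ^ 2 := hanti self_mem_Ici ht ht
  have hZ0 : Z 0 = 0 := by simp [hZ]
  have hZt : Z t = 0 := by
    rw [hZ0] at h0
    simpa using h0
  obtain ⟨h, e⟩ := hmem t ht
  have : (⟨Z t, h⟩ : A.domain) = 0 := Subtype.ext hZt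
  rw [this, A.map_zero] at e
  exact (sub_eq_zero.1 e.symm)

/-- The Lumer–Phillips theorem in a Hilbert space. -/
theorem wellPosed_of_maximal_dissipative {A : E →ₗ.[ℂ] E}
    (hdiss : ∀ x : A.domain, (inner ℂ (x : E) (A x)).re ≤ 0)
    (hsurj : ∀ y, ∃ x : A.domain, (x : E) - A x = y) (u₀ : E) :
    ∃ u : ℝ → E, IsMildSolution A u₀ u ∧
      (∀ v : ℝ → E, IsMildSolution A u₀ v → EqOn v u (Ici 0)) ∧
      (u₀ ∈ A.domain →
        ContinuousInDomain A u ∧ C1OnHalfLine u ∧ SolvesPointwise A u₀ u) := by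
  have hre : ∀ x : E, (inner ℂ x x).re = ‖x‖ ^ 2 := fun x => by
    rw [inner_self_eq_norm_sq_to_K]
    simp only [Complex.coe_algebraMap, ← Complex.ofReal_pow, Complex.ofReal_re]
  obtain ⟨K, hK1, hK2⟩ := exists_bounded_inverse (A.domain.subtype - A.toFun) (fun x => by
    have e : (inner ℂ ((A.domain.subtype - A.toFun) x) (x : E)).re =
        ‖(x : E)‖ ^ 2 - (inner ℂ (x : E) (A x)).re := by
      rw [← inner_conj_symm, Complex.conj_re, ← hre, ← Complex.sub_re, ← inner_sub_right]
      rfl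
    rw [e]
    linarith [hdiss x, sq_nonneg ‖(x : E)‖]) hsurj
  replace hK1 : ∀ y, ∃ h : K y ∈ A.domain, A ⟨K y, h⟩ = K y - y := fun y => by
    obtain ⟨h, e⟩ := hK1 y
    refine ⟨h, ?_⟩
    rw [eq_sub_iff_add_eq, ← eq_sub_iff_add_eq']
    exact e.symm
  replace hK2 : ∀ x : A.domain, K (x - A x) = x := hK2
  have hfirm : FirmlyNonexpansive K := by
    intro y
    obtain ⟨h, e⟩ := hK1 y
    have h1 := hdiss ⟨K y, h⟩
    rw [e, inner_sub_right, Complex.sub_re, hre] at h1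
    linarith
  -- For `z` orthogonal to the range, `‖K z‖² ≤ Re ⟨K z, z⟩ = 0`; then `K z = 0` and `A (K z) = K z
  -- - z` gives `z = 0`.
  have hdense : DenseRange K := by
    have h1 : (LinearMap.range K.toLinearMap).topologicalClosure = ⊤ := by
      rw [Submodule.topologicalClosure_eq_top_iff, Submodule.eq_bot_iff]
      intro z hz
      have h2 : inner ℂ (K z) z = 0 := (Submodule.mem_orthogonal _ _).1 hz _ ⟨z, rfl⟩
      have h3 := hfirm z
      rw [h2, Complex.zero_re] at h3
      have h4 : K z = 0 := by simpa using h3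
      obtain ⟨h, e⟩ := hK1 z
      have : (⟨K z, h⟩ : A.domain) = 0 := Subtype.ext h4
      rw [this, A.map_zero, h4, zero_sub] at e
      exact neg_eq_zero.1 e.symm
    have h2 := (Submodule.dense_iff_topologicalClosure_eq_top).2 h1
    exact h2
  obtain ⟨S, hSc, hS0, hSK, hSi, hSs⟩ := hfirm.exists_semigroup hdense
  have hmild : IsMildSolution A u₀ fun t => S t u₀ := by
    refine ⟨hSc u₀, fun t ht => ?_⟩
    set J := ∫ s in (0 : ℝ)..t, S s u₀ with hJ
    have hint := intervalIntegrable_of_Ici (hSc u₀) ht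
    -- The integrated equation is known on the range of `K` only; applying it to `K u₀` and moving
    -- `K` out of the integral exhibits `J` as a value of `K`, hence as an element of the domain.
    have h1 : K (S t u₀) - K u₀ = K J - J := by
      rw [hSK t ht, hSi t ht, add_sub_cancel_left, hJ,
        ← ContinuousLinearMap.intervalIntegral_comp_comm K hint,
        ← intervalIntegral.integral_sub _ hint]
      · refine intervalIntegral.integral_congr fun s hs => ?_
        rw [uIcc_of_le ht] at hs
        simp only [hSs s hs.1, hSK s hs.1]
      · exact intervalIntegrable_of_Ici (K.continuous.comp_continuousOn (hSc u₀)) ht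
    have h2 : K (J - S t u₀ + u₀) = J := by
      rw [map_add, map_sub, sub_add, h1]
      abel
    obtain ⟨h, e⟩ := hK1 (J - S t u₀ + u₀)
    have h3 : J ∈ A.domain := h2 ▸ h
    refine ⟨h3, ?_⟩
    have h4 : (⟨J, h3⟩ : A.domain) = ⟨_, h⟩ := Subtype.ext h2.symm
    rw [h4, e, h2]
    abel
  refine ⟨fun t => S t u₀, hmild, fun v hv => hmild.eqOn hdiss hv, fun hu₀ => ?_⟩
  obtain ⟨z, hz⟩ : ∃ z, K z = u₀ := ⟨_, hK2 ⟨u₀, hu₀⟩⟩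
  -- Since `u₀ = K z`, the vector `u₀ - z` is `A u₀`: the generator commutes with the semigroup.
  have hA : ∀ t, 0 ≤ t → ∃ h : S t u₀ ∈ A.domain, A ⟨S t u₀, h⟩ = S t (u₀ - z) := by
    intro t ht
    have h1 : S t u₀ = K (S t z) := by rw [hSK t ht, hz]
    obtain ⟨h, e⟩ := hK1 (S t z)
    have h3 : S t u₀ ∈ A.domain := h1 ▸ h
    refine ⟨h3, ?_⟩
    have h4 : (⟨S t u₀, h3⟩ : A.domain) = ⟨_, h⟩ := Subtype.ext h1
    rw [h4, e, hSs t ht, ← h1]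
  set g : ℝ → E := fun s => S (max s 0) (u₀ - z) with hg
  have hgc : Continuous g := continuous_comp_max (hSc (u₀ - z))
  have hd : ∀ t, HasDerivAt (fun t => u₀ + ∫ s in (0 : ℝ)..t, g s) (g t) t := fun t =>
    ((hgc.integral_hasStrictDerivAt 0 t).hasDerivAt).const_add u₀
  have heq : EqOn (fun t => S t u₀) (fun t => u₀ + ∫ s in (0 : ℝ)..t, g s) (Ici 0) := by
    intro t ht
    simp only [hg]
    rw [integral_comp_max (fun s => S s (u₀ - z)) ht, ← hz]
    exact hSi t ht z
  refine ⟨⟨fun t => (hA t t.2).1, ?_⟩, ?_, hS0 u₀, fun t ht => ?_⟩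
  · have h1 : (fun t : Ici (0 : ℝ) => A ⟨S t u₀, (hA t t.2).1⟩) =
        fun t : Ici (0 : ℝ) => S t (u₀ - z) := funext fun t => (hA t t.2).2
    exact (hSc u₀).domRestrict.prodMk (h1 ▸ (hSc (u₀ - z)).domRestrict)
  · refine ContDiffOn.congr ?_ heq
    refine ContDiff.contDiffOn ?_
    rw [contDiff_one_iff_deriv]
    refine ⟨fun t => (hd t).differentiableAt, ?_⟩
    rwa [show deriv (fun t => u₀ + ∫ s in (0 : ℝ)..t, g s) = g from funext fun t => (hd t).deriv]
  · obtain ⟨h, e⟩ := hA t ht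
    refine ⟨h, ?_⟩
    have h1 : g t = A ⟨S t u₀, h⟩ := by rw [e]; simp only [hg, max_eq_left ht]
    rw [← h1]
    exact (hd t).hasDerivWithinAt.congr heq (heq ht)

end WellPosed

/-! ### Complex-valued absolutely continuous functions -/

lemma absolutelyContinuousOnInterval_const (c : ℂ) (a b : ℝ) :
    AbsolutelyContinuousOnInterval (fun _ => c) a b := by
  simpa [AbsolutelyContinuousOnInterval] using tendsto_const_nhds

lemma absolutelyContinuousOnInterval_ofReal {f : ℝ → ℝ} {a b : ℝ}
    (hf : AbsolutelyContinuousOnInterval f a b) :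
    AbsolutelyContinuousOnInterval (fun x => (f x : ℂ)) a b := by
  simpa [AbsolutelyContinuousOnInterval, Complex.dist_eq, ← Complex.ofReal_sub, Real.dist_eq]
    using hf

lemma absolutelyContinuousOnInterval_conj {f : ℝ → ℂ} {a b : ℝ}
    (hf : AbsolutelyContinuousOnInterval f a b) :
    AbsolutelyContinuousOnInterval (fun x => starRingEnd ℂ (f x)) a b := by
  simpa [AbsolutelyContinuousOnInterval, Complex.dist_conj_conj] using hf

lemma absolutelyContinuousOnInterval_congr {f g : ℝ → ℂ} {a b : ℝ}
    (hf : AbsolutelyContinuousOnInterval f a b) (h : EqOn g f (uIcc a b)) :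
    AbsolutelyContinuousOnInterval g a b := by
  refine Tendsto.congr' ?_ hf
  rw [EventuallyEq, eventually_inf_principal]
  refine Eventually.of_forall fun I hI => Finset.sum_congr rfl fun i hi => ?_
  rw [h (hI.1 i hi).1, h (hI.1 i hi).2]

/-- Real and imaginary parts reduce this to real-valued primitives. -/
lemma absolutelyContinuousOnInterval_integral {f : ℝ → ℂ} {a b c : ℝ}
    (h : IntervalIntegrable f volume a b) (hc : c ∈ uIcc a b) :
    AbsolutelyContinuousOnInterval (fun x => ∫ y in c..x, f y) a b := by
  have hre : IntervalIntegrable (fun x => (f x).re) volume a b := ⟨h.1.re, h.2.re⟩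
  have him : IntervalIntegrable (fun x => (f x).im) volume a b := ⟨h.1.im, h.2.im⟩
  have h1 := absolutelyContinuousOnInterval_ofReal
    (hre.absolutelyContinuousOnInterval_intervalIntegral hc)
  have h2 := (absolutelyContinuousOnInterval_ofReal
    (him.absolutelyContinuousOnInterval_intervalIntegral hc)).const_smul Complex.I
  refine absolutelyContinuousOnInterval_congr (h1.add h2) fun x hx => ?_
  have hs : uIcc c x ⊆ uIcc a b := uIcc_subset_uIcc hc hx
  have e : ∀ y, f y = ((f y).re : ℂ) + Complex.I • ((f y).im : ℂ) := fun y => by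
    simp [mul_comm Complex.I, Complex.re_add_im]
  rw [intervalIntegral.integral_congr (g := fun y => ((f y).re : ℂ) + Complex.I • ((f y).im : ℂ))
    fun y _ => e y, intervalIntegral.integral_add, intervalIntegral.integral_smul,
    intervalIntegral.integral_ofReal, intervalIntegral.integral_ofReal]
  · rfl
  · exact ⟨(hre.mono_set hs).1.ofReal, (hre.mono_set hs).2.ofReal⟩
  · exact ⟨(him.mono_set hs).1.ofReal.smul Complex.I, (him.mono_set hs).2.ofReal.smul Complex.I⟩

/-- Subtracting the primitive of `deriv f` leaves an absolutely continuous function with derivative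
zero almost everywhere, hence a constant. -/
lemma integral_deriv_eq_sub_of_absolutelyContinuous {f : ℝ → ℂ} {a b : ℝ}
    (hf : AbsolutelyContinuousOnInterval f a b) (hi : IntervalIntegrable (deriv f) volume a b) :
    ∫ x in a..b, deriv f x = f b - f a := by
  have hg := hf.sub (absolutelyContinuousOnInterval_integral hi (c := a) (by simp))
  have hg0 : ∀ᵐ x, x ∈ uIcc a b →
      HasDerivAt (f - fun x => ∫ y in a..x, deriv f y) 0 x := by
    filter_upwards [hf.boundedVariationOn.ae_differentiableAt_of_mem_uIcc,
      hi.ae_hasDerivAt_integral] with x hx₁ hx₂ hx₃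
    simpa using (hx₁ hx₃).hasDerivAt.sub (hx₂ hx₃ a (by simp))
  obtain ⟨C, hC⟩ := hg.const_of_ae_hasDerivAt_zero hg0
  have h1 := hC a (by simp)
  have h2 := hC b (by simp)
  simp only [Pi.sub_apply, intervalIntegral.integral_same, sub_zero] at h1 h2
  rw [h1, ← h2]
  ring

lemma integral_deriv_mul_conj {f v : ℝ → ℂ} {a b : ℝ}
    (hv : AbsolutelyContinuousOnInterval v a b) (hf : AbsolutelyContinuousOnInterval f a b)
    (hi : IntervalIntegrable (fun x => deriv v x * starRingEnd ℂ (f x) +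
      v x * starRingEnd ℂ (deriv f x)) volume a b) :
    ∫ x in a..b, (deriv v x * starRingEnd ℂ (f x) + v x * starRingEnd ℂ (deriv f x)) =
      v b * starRingEnd ℂ (f b) - v a * starRingEnd ℂ (f a) := by
  have hh := hv.smul (absolutelyContinuousOnInterval_conj hf)
  set h : ℝ → ℂ := v • fun x => starRingEnd ℂ (f x)
  have hd : ∀ᵐ x, x ∈ uIcc a b →
      deriv h x = deriv v x * starRingEnd ℂ (f x) + v x * starRingEnd ℂ (deriv f x) := by
    filter_upwards [hv.boundedVariationOn.ae_differentiableAt_of_mem_uIcc,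
      hf.boundedVariationOn.ae_differentiableAt_of_mem_uIcc] with x h1 h2 hx
    have h3 : HasDerivAt (fun x => starRingEnd ℂ (f x)) (starRingEnd ℂ (deriv f x)) x :=
      (Complex.conjCLE.toContinuousLinearMap.hasFDerivAt.comp_hasDerivAt x (h2 hx).hasDerivAt)
    exact ((h1 hx).hasDerivAt.mul h3).deriv
  have hd' : ∀ᵐ x, x ∈ uIoc a b →
      deriv h x = deriv v x * starRingEnd ℂ (f x) + v x * starRingEnd ℂ (deriv f x) := by
    filter_upwards [hd] with x hx hx' using hx (uIoc_subset_uIcc hx')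
  rw [← intervalIntegral.integral_congr_ae hd']
  rw [integral_deriv_eq_sub_of_absolutelyContinuous hh]
  · rfl
  · refine hi.congr_ae ?_
    rw [Filter.EventuallyEq, ae_restrict_iff' measurableSet_uIoc]
    filter_upwards [hd'] with x hx hx' using (hx hx').symm

/-- Non-integrability of `1/x` at `0` is the source of both contradictions at the degenerate point:
for `τ |f'|²` and for `|f|²`. -/
lemma not_integrableOn_of_inv_le {g : ℝ → ℝ} (hg : IntegrableOn g (Ioo 0 1)) {c δ : ℝ}
    (hc : 0 < c) (hδ : 0 < δ) (hδ1 : δ ≤ 1)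
    (h : ∀ᵐ x ∂volI, x < δ → c / x ≤ g x) : False := by
  have h1 : ¬ IntervalIntegrable (fun x : ℝ => x⁻¹) volume 0 δ := by
    rw [intervalIntegrable_inv_iff]
    simp [hδ.le, hδ.ne]
  apply h1
  rw [intervalIntegrable_iff_integrableOn_Ioo_of_le hδ.le]
  have hsub : Ioo 0 δ ⊆ Ioo (0 : ℝ) 1 := Ioo_subset_Ioo_right hδ1
  refine Integrable.mono' ((hg.mono_set hsub).const_mul c⁻¹) (by fun_prop) ?_
  rw [volI, ae_restrict_iff' measurableSet_Ioo] at h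
  rw [ae_restrict_iff' measurableSet_Ioo]
  filter_upwards [h] with x hx hx'
  have := hx (hsub hx') hx'.2
  have h0 := hx'.1
  rw [Real.norm_of_nonneg (by positivity), ← div_eq_inv_mul, le_div_iff₀ hc]
  rwa [div_eq_inv_mul] at this

/-- Cauchy–Schwarz for primitives. -/
lemma exists_norm_integral_le_sqrt {g : ℝ → ℂ} (hg : MemLp g 2 volI) :
    ∃ M > 0, ∀ x ∈ Ioc (0 : ℝ) 1, ‖∫ y in (0 : ℝ)..x, g y‖ ≤ M * √x := by
  have hsq : IntegrableOn (fun x => ‖g x‖ ^ 2) (Ioo 0 1) :=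
    (memLp_two_iff_integrable_sq_norm hg.1).1 hg
  have h1 : IntegrableOn g (Ioo 0 1) := hg.integrable (by norm_num)
  set G := ∫ x in Ioo (0 : ℝ) 1, ‖g x‖ ^ 2
  have hG : 0 ≤ G := integral_nonneg fun _ => by positivity
  -- A weighted arithmetic–geometric inequality replaces Cauchy–Schwarz: `‖g‖ ≤ 1/(2√x) + (√x/2)
  -- ‖g‖²`, integrated over `(0, x)`.
  refine ⟨(1 + G) / 2, by positivity, fun x hx => ?_⟩
  have hsub : Ioo 0 x ⊆ Ioo (0 : ℝ) 1 := Ioo_subset_Ioo_right hx.2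
  have hs : 0 < √x := Real.sqrt_pos.2 hx.1
  rw [intervalIntegral.integral_of_le hx.1.le, integral_Ioc_eq_integral_Ioo]
  calc ‖∫ y in Ioo 0 x, g y‖ ≤ ∫ y in Ioo 0 x, ‖g y‖ := norm_integral_le_integral_norm _
    _ ≤ ∫ y in Ioo 0 x, ((√x)⁻¹ / 2 + √x / 2 * ‖g y‖ ^ 2) := by
      refine integral_mono (h1.mono_set hsub).norm
        ((integrable_const _).add ((hsq.mono_set hsub).const_mul _)) fun y => ?_
      have h2 := sq_nonneg (√x * ‖g y‖ - 1)
      have h3 : √x * (√x)⁻¹ = 1 := mul_inv_cancel₀ hs.ne'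
      have h4 : 0 < (√x)⁻¹ := by positivity
      have h5 : ((√x)⁻¹ / 2 + √x / 2 * ‖g y‖ ^ 2) - ‖g y‖ =
        (√x)⁻¹ / 2 * (√x * ‖g y‖ - 1) ^ 2 := by field_simp; ring
      have h6 : 0 ≤ (√x)⁻¹ / 2 * (√x * ‖g y‖ - 1) ^ 2 := by positivity
      simp only
      linarith
    _ = √x / 2 + √x / 2 * ∫ y in Ioo 0 x, ‖g y‖ ^ 2 := by
      rw [integral_add (integrable_const _) ((hsq.mono_set hsub).const_mul _),
        integral_const_mul]
      congr 1
      have h3 : x * (√x)⁻¹ = √x := by rw [← div_eq_mul_inv, Real.div_sqrt]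
      simp [hx.1.le]
      linear_combination h3 / 2
    _ ≤ √x / 2 + √x / 2 * G := by
      gcongr
      exact setIntegral_mono_set hsq (Eventually.of_forall fun _ => by positivity)
        (Eventually.of_forall hsub)
    _ = _ := by ring

/-! ### The coefficient -/

namespace Data

variable (P : Data)

/-- `m_τ` as a real number. -/
noncomputable def m : ℝ := (degIndex P.τ).toReal

lemma degIndex_ne_top : degIndex P.τ ≠ ∞ := (P.degIndex_lt_two.trans (by simp)).ne

lemma m_lt_two : P.m < 2 := by
  have := (ENNReal.toReal_lt_toReal P.degIndex_ne_top (by simp)).2 P.degIndex_lt_two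
  simpa using! this

lemma m_lt_one_iff : P.m < 1 ↔ degIndex P.τ < 1 := by
  rw [← ENNReal.toReal_lt_toReal P.degIndex_ne_top (by simp)]
  simp [m]

lemma abs_derivWithin_le {x : ℝ} (hx : x ∈ Ioc (0 : ℝ) 1) :
    x * |derivWithin P.τ (Ioc 0 1) x| ≤ P.m * P.τ x := by
  have h : ENNReal.ofReal (x * |derivWithin P.τ (Ioc 0 1) x| / P.τ x) ≤ degIndex P.τ :=
    le_iSup₂ (f := fun x (_ : x ∈ Ioc (0 : ℝ) 1) =>
      ENNReal.ofReal (x * |derivWithin P.τ (Ioc 0 1) x| / P.τ x)) x hx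
  rw [ENNReal.ofReal_le_iff_le_toReal P.degIndex_ne_top, div_le_iff₀ (P.τ_pos x hx)] at h
  exact h

lemma τ_one_pos : 0 < P.τ 1 := P.τ_pos 1 ⟨one_pos, le_rfl⟩

/-- The bound `x τ' ≤ m τ` says that `τ x^{-m}` is nonincreasing; compare with its value at `1`. -/
lemma mul_rpow_le_τ {x : ℝ} (hx : x ∈ Ioc (0 : ℝ) 1) : P.τ 1 * x ^ P.m ≤ P.τ x := by
  have hdiff : DifferentiableOn ℝ P.τ (Ioc 0 1) := P.contDiffOn_τ.differentiableOn one_ne_zero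
  have hd : ∀ x ∈ Ioo (0 : ℝ) 1, HasDerivAt (fun x => P.τ x * x ^ (-P.m))
      (derivWithin P.τ (Ioc 0 1) x * x ^ (-P.m) + P.τ x * (-P.m * x ^ (-P.m - 1))) x := by
    intro x hx
    have h1 : HasDerivAt P.τ (derivWithin P.τ (Ioc 0 1) x) x :=
      (hdiff x (Ioo_subset_Ioc_self hx)).hasDerivWithinAt.hasDerivAt (Ioc_mem_nhds hx.1 hx.2)
    exact h1.mul (Real.hasDerivAt_rpow_const (Or.inl hx.1.ne'))
  have hanti : AntitoneOn (fun x => P.τ x * x ^ (-P.m)) (Ioc 0 1) := by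
    refine antitoneOn_of_deriv_nonpos (convex_Ioc 0 1) ?_ ?_ fun x hx => ?_
    · refine hdiff.continuousOn.mul (continuousOn_id.rpow_const fun x hx => Or.inl hx.1.ne')
    · rw [interior_Ioc]
      exact fun x hx => (hd x hx).differentiableAt.differentiableWithinAt
    · rw [interior_Ioc] at hx
      rw [(hd x hx).deriv, Real.rpow_sub_one hx.1.ne']
      have h1 := P.abs_derivWithin_le (Ioo_subset_Ioc_self hx)
      have h2 : 0 < x ^ (-P.m) := Real.rpow_pos_of_pos hx.1 _
      have h3 : x * derivWithin P.τ (Ioc 0 1) x ≤ P.m * P.τ x :=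
        (mul_le_mul_of_nonneg_left (le_abs_self _) hx.1.le).trans h1
      have h4 : derivWithin P.τ (Ioc 0 1) x * x ^ (-P.m) +
          P.τ x * (-P.m * (x ^ (-P.m) / x)) =
          x ^ (-P.m) / x * (x * derivWithin P.τ (Ioc 0 1) x - P.m * P.τ x) := by
        have := hx.1.ne'
        field_simp
        ring
      rw [h4]
      exact mul_nonpos_of_nonneg_of_nonpos (div_nonneg h2.le hx.1.le) (by linarith)
  have h := hanti hx ⟨one_pos, le_rfl⟩ hx.2
  simp only [Real.one_rpow, mul_one] at h
  rw [Real.rpow_neg hx.1.le] at h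
  rwa [← le_div_iff₀ (Real.rpow_pos_of_pos hx.1 _)]

/-- If `m_τ ≥ 1`, then `[m_τ] ≥ 1`, so `τ` is differentiable at `0`, where it vanishes. This is
where the regularity `C^{[m_τ]}` enters. -/
lemma exists_τ_le (hm : ¬ degIndex P.τ < 1) :
    ∃ C > 0, ∃ δ > 0, δ ≤ 1 ∧ ∀ x ∈ Ioo (0 : ℝ) δ, P.τ x ≤ C * x := by
  rw [← m_lt_one_iff, not_lt] at hm
  have h1 : (1 : ℕ) ≤ ⌊(degIndex P.τ).toReal⌋₊ := (Nat.one_le_floor_iff _).2 hm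
  have h2 : DifferentiableWithinAt ℝ P.τ (Icc 0 1) 0 :=
    (P.contDiffOn_floor.differentiableOn (by
      have : (⌊(degIndex P.τ).toReal⌋₊ : WithTop ℕ∞) ≠ 0 := by
        exact_mod_cast (by omega : ⌊(degIndex P.τ).toReal⌋₊ ≠ 0)
      exact_mod_cast this)) 0 ⟨le_rfl, zero_le_one⟩
  obtain ⟨C, hC⟩ := h2.hasFDerivWithinAt.isBigO_sub.bound
  rw [eventually_iff, Metric.mem_nhdsWithin_iff] at hC
  obtain ⟨δ, hδ, hC⟩ := hC
  refine ⟨|C| + 1, by positivity, min δ 1, by positivity, min_le_right _ _, fun x hx => ?_⟩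
  have hx1 : x < 1 := hx.2.trans_le (min_le_right _ _)
  have hxδ : x < δ := hx.2.trans_le (min_le_left _ _)
  have h3 := hC ⟨by simp [abs_of_pos hx.1, hxδ], hx.1.le, hx1.le⟩
  simp only [P.τ_zero, sub_zero, mem_ofPred_eq, Real.norm_eq_abs, abs_of_pos hx.1] at h3
  calc P.τ x ≤ C * x := (le_abs_self _).trans h3
    _ ≤ (|C| + 1) * x := mul_le_mul_of_nonneg_right (by linarith [le_abs_self C]) hx.1.le

end Data

/-! ### Dissipativity -/

lemma MemH1.continuousOn {v : ℝ → ℂ} (hv : MemH1 v) : ContinuousOn v (Icc 0 1) := by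
  simpa [uIcc_of_le zero_le_one] using hv.1.continuousOn

lemma MemH1.tendsto_zero {v : ℝ → ℂ} (hv : MemH1 v) : Tendsto v (𝓝[>] 0) (𝓝 (v 0)) :=
  (hv.continuousOn 0 ⟨le_rfl, zero_le_one⟩).mono_left
    (nhdsWithin_le_of_mem (Icc_mem_nhdsGT zero_lt_one))

lemma MemH1.eq_add_integral {v : ℝ → ℂ} (hv : MemH1 v) {x : ℝ} (hx : x ∈ Icc (0 : ℝ) 1) :
    v x = v 0 + ∫ y in (0 : ℝ)..x, deriv v y := by
  have hi : IntervalIntegrable (deriv v) volume 0 1 := by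
    rw [intervalIntegrable_iff_integrableOn_Ioo_of_le zero_le_one]
    exact hv.2.integrable (by norm_num)
  have hs : uIcc 0 x ⊆ uIcc (0 : ℝ) 1 := by
    rw [uIcc_of_le hx.1, uIcc_of_le zero_le_one]
    exact Icc_subset_Icc_right hx.2
  rw [integral_deriv_eq_sub_of_absolutelyContinuous (hv.1.mono hs) (hi.mono_set hs)]
  ring

lemma exists_Ioo_of_eventually_nhdsGT {p : ℝ → Prop} (h : ∀ᶠ x in 𝓝[>] (0 : ℝ), p x) :
    ∃ δ > 0, δ ≤ 1 ∧ ∀ x ∈ Ioo 0 δ, p x := by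
  obtain ⟨δ, hδ, h⟩ := mem_nhdsGT_iff_exists_Ioo_subset.1 h
  exact ⟨min δ 1, lt_min hδ one_pos, min_le_right _ _,
    fun x hx => h ⟨hx.1, hx.2.trans_le (min_le_left _ _)⟩⟩

namespace Data

variable {P : Data} {f v : ℝ → ℂ}

lemma flux_mul_conj_deriv_eq (h : MemH2τ P.τ f v) :
    (fun x => v x * starRingEnd ℂ (deriv f x)) =ᵐ[volI]
      fun x => ((‖(√(P.τ x) : ℂ) * deriv f x‖ ^ 2 : ℝ) : ℂ) := by
  filter_upwards [h.2.2, ae_restrict_mem measurableSet_Ioo] with x hx hx'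
  have h0 := (P.τ_pos x (Ioo_subset_Ioc_self hx')).le
  rw [hx, norm_mul, mul_pow, Complex.norm_real, Real.norm_eq_abs, sq_abs, Real.sq_sqrt h0,
    mul_assoc, Complex.mul_conj, Complex.normSq_eq_norm_sq]
  push_cast
  rfl

/-- The flux vanishes at the degenerate point in the strongly degenerate case. -/
lemma flux_zero (h : MemH2τ P.τ f v) (hm : ¬ degIndex P.τ < 1) : v 0 = 0 := by
  by_contra hv0
  obtain ⟨C, hC, δ₁, hδ₁, -, h1⟩ := P.exists_τ_le hm
  have hpos : 0 < ‖v 0‖ := norm_pos_iff.2 hv0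
  obtain ⟨δ₂, hδ₂, hδ₂', h2⟩ := exists_Ioo_of_eventually_nhdsGT
    (h.2.1.tendsto_zero.norm.eventually_const_lt (show ‖v 0‖ / 2 < ‖v 0‖ by linarith))
  have hsq := (memLp_two_iff_integrable_sq_norm h.1.2.2.1).1 h.1.2.2
  -- If `v 0 ≠ 0`, then near `0` the integrable function `τ |f'|² = |v|² / τ` exceeds `(‖v 0‖/2)² /
  -- (C x)`.
  refine not_integrableOn_of_inv_le hsq (c := (‖v 0‖ / 2) ^ 2 / C) (δ := min δ₁ δ₂) (by positivity)
    (by positivity) ((min_le_right _ _).trans hδ₂') ?_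
  filter_upwards [h.2.2, ae_restrict_mem measurableSet_Ioo] with x hx hx' hxδ
  have h0 := P.τ_pos x (Ioo_subset_Ioc_self hx')
  have h3 := h1 x ⟨hx'.1, hxδ.trans_le (min_le_left _ _)⟩
  have h4 := h2 x ⟨hx'.1, hxδ.trans_le (min_le_right _ _)⟩
  have h5 : ‖(√(P.τ x) : ℂ) * deriv f x‖ ^ 2 = ‖v x‖ ^ 2 / P.τ x := by
    rw [hx, norm_mul, norm_mul, mul_pow, mul_pow, Complex.norm_real, Complex.norm_real,
      Real.norm_eq_abs, Real.norm_eq_abs, sq_abs, sq_abs, Real.sq_sqrt h0.le]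
    field_simp
  have h6 := hx'.1
  rw [h5, div_div]
  gcongr

/-- In the weak case `f → 0` and `v` is bounded. In the strong case `v 0 = 0` gives `|v| ≤ M √x`, so
a nonzero limit would force `|f|² ≥ c / x`, against `f ∈ L²`. -/
lemma tendsto_flux_mul_conj (h : MemH2τ P.τ f v) (hW : MemW1 P.τ f) {L : ℂ}
    (hL : Tendsto (fun x => v x * starRingEnd ℂ (f x)) (𝓝[>] 0) (𝓝 L)) : L = 0 := by
  by_cases hm : degIndex P.τ < 1
  · have h1 := h.2.1.tendsto_zero.mul ((Complex.continuous_conj.tendsto _).comp (hW.2 hm))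
    simp only [map_zero, mul_zero] at h1
    exact tendsto_nhds_unique hL h1
  · by_contra hL0
    have hpos : 0 < ‖L‖ := norm_pos_iff.2 hL0
    obtain ⟨M, hM, h1⟩ := exists_norm_integral_le_sqrt h.2.1.2
    obtain ⟨δ, hδ, hδ', h2⟩ := exists_Ioo_of_eventually_nhdsGT
      (hL.norm.eventually_const_lt (show ‖L‖ / 2 < ‖L‖ by linarith))
    have hsq := (memLp_two_iff_integrable_sq_norm h.1.1.1).1 h.1.1
    refine not_integrableOn_of_inv_le hsq (c := (‖L‖ / 2 / M) ^ 2) (by positivity) hδ hδ' ?_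
    filter_upwards [ae_restrict_mem measurableSet_Ioo] with x hx hxδ
    have h3 := h2 x ⟨hx.1, hxδ⟩
    have h4 := h1 x (Ioo_subset_Ioc_self hx)
    have h5 := h.2.1.eq_add_integral (Ioo_subset_Icc_self hx)
    rw [flux_zero h hm, zero_add] at h5
    rw [← h5] at h4
    rw [norm_mul, RCLike.norm_conj] at h3
    have hs : 0 < √x := Real.sqrt_pos.2 hx.1
    have h6 : ‖L‖ / 2 ≤ M * √x * ‖f x‖ :=
      h3.le.trans (mul_le_mul_of_nonneg_right h4 (norm_nonneg _))
    have h7 : ‖L‖ / 2 / M / √x ≤ ‖f x‖ := by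
      rw [div_div, div_le_iff₀ (by positivity)]
      linarith
    calc (‖L‖ / 2 / M) ^ 2 / x = (‖L‖ / 2 / M / √x) ^ 2 := by
          rw [div_pow _ (√x), Real.sq_sqrt hx.1.le]
      _ ≤ ‖f x‖ ^ 2 := by gcongr

lemma integrable_deriv_flux_mul_conj (h : MemH2τ P.τ f v) :
    Integrable (fun x => deriv v x * starRingEnd ℂ (f x)) volI :=
  h.2.1.2.integrable_mul h.1.1.star

/-- Integration by parts, with no contribution of the degenerate point. -/
lemma integral_deriv_flux_mul_conj (h : MemH2τ P.τ f v) (hW : MemW1 P.τ f) :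
    ∫ x in Ioo (0 : ℝ) 1, deriv v x * starRingEnd ℂ (f x) =
      v 1 * starRingEnd ℂ (f 1) -
        ((∫ x in Ioo (0 : ℝ) 1, ‖(√(P.τ x) : ℂ) * deriv f x‖ ^ 2 : ℝ) : ℂ) := by
  have i1 := integrable_deriv_flux_mul_conj h
  have i2 : Integrable (fun x => ((‖(√(P.τ x) : ℂ) * deriv f x‖ ^ 2 : ℝ) : ℂ)) volI :=
    ((memLp_two_iff_integrable_sq_norm h.1.2.2.1).1 h.1.2.2).ofReal
  have i3 : Integrable (fun x => v x * starRingEnd ℂ (deriv f x)) volI :=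
    i2.congr (flux_mul_conj_deriv_eq h).symm
  set g : ℝ → ℂ := fun x => deriv v x * starRingEnd ℂ (f x) + v x * starRingEnd ℂ (deriv f x)
    with hg
  have ig : IntervalIntegrable g volume 0 1 := by
    rw [intervalIntegrable_iff_integrableOn_Ioo_of_le zero_le_one]
    exact i1.add i3
  have h1 : ∀ δ ∈ Ioo (0 : ℝ) 1, v δ * starRingEnd ℂ (f δ) =
      v 1 * starRingEnd ℂ (f 1) - ∫ x in δ..1, g x := by
    intro δ hδ
    rw [integral_deriv_mul_conj (h.2.1.locAC δ hδ) (h.1.2.1 δ hδ)]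
    · ring
    · refine ig.mono_set ?_
      rw [uIcc_of_le hδ.2.le, uIcc_of_le zero_le_one]
      exact Icc_subset_Icc_left hδ.1.le
  have h2 : Tendsto (fun δ => ∫ x in δ..1, g x) (𝓝[>] 0) (𝓝 (∫ x in (0 : ℝ)..1, g x)) := by
    have hc : ContinuousOn (fun δ => ∫ x in δ..1, g x) (uIcc 0 1) :=
      intervalIntegral.continuousOn_primitive_interval_left
        (by rw [uIcc_of_le zero_le_one, integrableOn_Icc_iff_integrableOn_Ioo]; exact i1.add i3)
    rw [uIcc_of_le zero_le_one] at hc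
    exact (hc 0 ⟨le_rfl, zero_le_one⟩).mono_left
      (nhdsWithin_le_of_mem (Icc_mem_nhdsGT zero_lt_one))
  -- Both terms of the product rule are integrable up to `0`, so the boundary term has some limit
  -- there; only then can it be identified as zero.
  have h3 : Tendsto (fun x => v x * starRingEnd ℂ (f x)) (𝓝[>] 0)
      (𝓝 (v 1 * starRingEnd ℂ (f 1) - ∫ x in (0 : ℝ)..1, g x)) := by
    refine (h2.const_sub _).congr' ?_
    filter_upwards [Ioo_mem_nhdsGT zero_lt_one] with δ hδ using (h1 δ hδ).symm
  have h4 := tendsto_flux_mul_conj h hW h3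
  rw [intervalIntegral.integral_of_le zero_le_one, integral_Ioc_eq_integral_Ioo, hg,
    integral_add i1 i3, integral_congr_ae (flux_mul_conj_deriv_eq h), integral_complex_ofReal] at h4
  linear_combination -h4

lemma memLp_theta (U : P.H) : MemLp (theta U) 2 volume := by
  have h := (Lp.memLp U.snd).smul_measure (c := (ENNReal.ofReal P.ζ)⁻¹)
    (by simpa using P.ζ_pos)
  rwa [smul_smul, ENNReal.inv_mul_cancel (by simpa using P.ζ_pos) ENNReal.ofReal_ne_top,
    one_smul] at h

lemma integral_second_mul_conj {U : P.H} (h : DomainRep U f v) :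
    ∫ ξ, (-((ξ ^ 2 + P.wp : ℝ) : ℂ) * theta U ξ + (P.η ξ : ℂ) * f 1) *
      starRingEnd ℂ (theta U ξ) =
      f 1 * starRingEnd ℂ (∫ ξ, (P.η ξ : ℂ) * theta U ξ) -
        ((∫ ξ, (ξ ^ 2 + P.wp) * ‖theta U ξ‖ ^ 2 : ℝ) : ℂ) := by
  have hθ := memLp_theta U
  have i1 : Integrable (fun ξ => (ξ ^ 2 + P.wp) * ‖theta U ξ‖ ^ 2) := by
    have j1 := (memLp_two_iff_integrable_sq_norm h.memLp_mul.1).1 h.memLp_mul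
    have j2 := ((memLp_two_iff_integrable_sq_norm hθ.1).1 hθ).const_mul P.wp
    refine (j1.add j2).congr (Eventually.of_forall fun ξ => ?_)
    simp only [Pi.add_apply, norm_mul, Complex.norm_real, Real.norm_eq_abs, mul_pow, sq_abs]
    ring
  have e : ∀ ξ, (-((ξ ^ 2 + P.wp : ℝ) : ℂ) * theta U ξ + (P.η ξ : ℂ) * f 1) *
      starRingEnd ℂ (theta U ξ) = f 1 * starRingEnd ℂ ((P.η ξ : ℂ) * theta U ξ) -
        (((ξ ^ 2 + P.wp) * ‖theta U ξ‖ ^ 2 : ℝ) : ℂ) := by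
    intro ξ
    have : theta U ξ * starRingEnd ℂ (theta U ξ) = ((‖theta U ξ‖ ^ 2 : ℝ) : ℂ) := by
      rw [Complex.mul_conj, Complex.normSq_eq_norm_sq]
    rw [map_mul, Complex.conj_ofReal, Complex.ofReal_mul, ← this]
    ring
  have i2 : Integrable (fun ξ => starRingEnd ℂ ((P.η ξ : ℂ) * theta U ξ)) :=
    (Complex.conjCLE.toContinuousLinearMap.integrable_comp h.integrable)
  simp_rw [e]
  have i3 : Integrable (fun ξ => (((ξ ^ 2 + P.wp) * ‖theta U ξ‖ ^ 2 : ℝ) : ℂ)) := i1.ofReal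
  rw [integral_sub (i2.const_mul _) i3, integral_const_mul, integral_conj,
    integral_complex_ofReal]

/-- With `w = ∫ η ϑ`, the boundary terms are `-ζ w conj(f 1)` and `ζ f(1) conj w`, whose sum is
purely imaginary, as is the term `-i ∫ τ |f'|²`. What remains is `-ζ ∫ (ξ² + wp) |ϑ|²`. -/
lemma IsGen.re_inner_nonpos {U F : P.H} (h : IsGen U F) : (inner ℂ U F).re ≤ 0 := by
  obtain ⟨f, v, hf, h1, h2⟩ := h
  rw [inner_eq]
  have e1 : ∫ x in Ioo (0 : ℝ) 1, psi F x * starRingEnd ℂ (psi U x) =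
      Complex.I * ∫ x in Ioo (0 : ℝ) 1, deriv v x * starRingEnd ℂ (f x) := by
    rw [← integral_const_mul]
    refine integral_congr_ae ?_
    filter_upwards [h1, hf.psi_eq] with x e1 e2
    rw [e1, e2, mul_assoc]
  have e2 : ∫ ξ, theta F ξ * starRingEnd ℂ (theta U ξ) =
      ∫ ξ, (-((ξ ^ 2 + P.wp : ℝ) : ℂ) * theta U ξ + (P.η ξ : ℂ) * f 1) *
      starRingEnd ℂ (theta U ξ) := by
    refine integral_congr_ae ?_
    filter_upwards [h2] with ξ e
    rw [e]
  rw [e1, e2, integral_deriv_flux_mul_conj hf.memH2 hf.memW1, integral_second_mul_conj hf,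
    hf.boundary]
  set w := ∫ ξ, (P.η ξ : ℂ) * theta U ξ
  set q := ∫ x in Ioo (0 : ℝ) 1, ‖(√(P.τ x) : ℂ) * deriv f x‖ ^ 2
  have hn : 0 ≤ ∫ ξ, (ξ ^ 2 + P.wp) * ‖theta U ξ‖ ^ 2 :=
    integral_nonneg fun ξ => mul_nonneg (by have := P.wp_nonneg; positivity) (by positivity)
  set n := ∫ ξ, (ξ ^ 2 + P.wp) * ‖theta U ξ‖ ^ 2
  have := mul_nonneg P.ζ_pos.le hn
  simp
  linarith

end Data

namespace Data

variable {P : Data}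

/-! ### The frequency variable -/

variable (P) in
/-- The symbol `ξ² + wp + 1`. -/
noncomputable def symb (ξ : ℝ) : ℝ := ξ ^ 2 + P.wp + 1

lemma one_le_symb (ξ : ℝ) : 1 ≤ P.symb ξ := by
  have := P.wp_nonneg
  unfold symb
  nlinarith [sq_nonneg ξ]

lemma symb_pos (ξ : ℝ) : 0 < P.symb ξ := zero_lt_one.trans_le (one_le_symb ξ)

lemma η_nonneg (ξ : ℝ) : 0 ≤ P.η ξ := Real.rpow_nonneg (abs_nonneg _) _

lemma measurable_η : Measurable P.η := by
  unfold η
  fun_prop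

lemma measurable_symb : Measurable P.symb := by
  unfold symb
  fun_prop

lemma η_sq {ξ : ℝ} (hξ : 0 < ξ) : P.η ξ ^ 2 = ξ ^ (2 * P.α - 1) := by
  rw [η, abs_of_pos hξ, ← Real.rpow_natCast, ← Real.rpow_mul hξ.le]
  congr 1
  push_cast
  ring

/-- Near `0` the function is at most `ξ^{2α-1}`, integrable as `α > 0`; at infinity at most
`ξ^{2α-3}`, integrable as `α < 1`. Evenness covers the negative half-line. -/
lemma integrable_η_sq_div_symb : Integrable fun ξ => P.η ξ ^ 2 / P.symb ξ := by
  have hmeas : Measurable fun ξ => P.η ξ ^ 2 / P.symb ξ :=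
    (measurable_η.pow_const 2).div measurable_symb
  have h0 : IntegrableOn (fun ξ => P.η ξ ^ 2 / P.symb ξ) (Ioc 0 1) := by
    have h1 : IntegrableOn (fun ξ : ℝ => ξ ^ (2 * P.α - 1)) (Ioc 0 1) := by
      rw [← intervalIntegrable_iff_integrableOn_Ioc_of_le zero_le_one]
      exact intervalIntegral.intervalIntegrable_rpow' (by linarith [P.α_pos])
    refine Integrable.mono' h1 hmeas.aestronglyMeasurable ?_
    filter_upwards [ae_restrict_mem measurableSet_Ioc] with ξ hξ
    rw [Real.norm_of_nonneg (div_nonneg (sq_nonneg _) (symb_pos ξ).le), ← η_sq hξ.1]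
    exact div_le_self (sq_nonneg _) (one_le_symb ξ)
  have h1 : IntegrableOn (fun ξ => P.η ξ ^ 2 / P.symb ξ) (Ioi 1) := by
    have h1 : IntegrableOn (fun ξ : ℝ => ξ ^ (2 * P.α - 3)) (Ioi 1) :=
      integrableOn_Ioi_rpow_of_lt (by linarith [P.α_lt_one]) one_pos
    refine Integrable.mono' h1 hmeas.aestronglyMeasurable ?_
    filter_upwards [ae_restrict_mem measurableSet_Ioi] with ξ hξ
    have hξ0 : 0 < ξ := zero_lt_one.trans hξ
    rw [Real.norm_of_nonneg (div_nonneg (sq_nonneg _) (symb_pos ξ).le), η_sq hξ0,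
      show 2 * P.α - 3 = 2 * P.α - 1 - (2 : ℕ) by push_cast; ring, Real.rpow_sub_natCast hξ0.ne']
    have hw := P.wp_nonneg
    refine div_le_div_of_nonneg_left (Real.rpow_nonneg hξ0.le _) (by positivity) ?_
    unfold symb
    linarith
  have h2 : IntegrableOn (fun ξ => P.η ξ ^ 2 / P.symb ξ) (Ioi 0) := by
    rw [← Ioc_union_Ioi_eq_Ioi zero_le_one]
    exact h0.union h1
  have h3 := (integrable_indicator_iff measurableSet_Ioi).2 h2
  refine (h3.add h3.comp_neg).congr ?_
  filter_upwards [Measure.ae_ne volume (0 : ℝ)] with ξ hξ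
  have heven : P.η (-ξ) ^ 2 / P.symb (-ξ) = P.η ξ ^ 2 / P.symb ξ := by simp [η, symb]
  rcases lt_or_gt_of_ne hξ with h | h
  · simp [h, h.le, heven]
  · simp [h, h.le]

variable (P) in
/-- `η / √(ξ² + wp + 1)`. -/
noncomputable def kernel (ξ : ℝ) : ℝ := P.η ξ / √(P.symb ξ)

lemma kernel_sq (ξ : ℝ) : P.kernel ξ ^ 2 = P.η ξ ^ 2 / P.symb ξ := by
  rw [kernel, div_pow, Real.sq_sqrt (symb_pos ξ).le]

lemma measurable_kernel : Measurable P.kernel := measurable_η.div measurable_symb.sqrt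

lemma memLp_kernel : MemLp P.kernel 2 := by
  rw [memLp_two_iff_integrable_sq measurable_kernel.aestronglyMeasurable]
  simp_rw [kernel_sq]
  exact integrable_η_sq_div_symb

lemma sqrt_symb_le (ξ : ℝ) : √(P.symb ξ) ≤ P.symb ξ := by
  rw [Real.sqrt_le_left (symb_pos ξ).le]
  nlinarith [one_le_symb (P := P) ξ]

lemma one_le_sqrt_symb (ξ : ℝ) : 1 ≤ √(P.symb ξ) := Real.one_le_sqrt.2 (one_le_symb ξ)

lemma abs_le_sqrt_symb (ξ : ℝ) : |ξ| ≤ √(P.symb ξ) := by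
  refine Real.abs_le_sqrt ?_
  have := P.wp_nonneg
  unfold symb
  linarith

lemma η_div_symb_le (ξ : ℝ) : P.η ξ / P.symb ξ ≤ P.kernel ξ :=
  div_le_div_of_nonneg_left (η_nonneg ξ) (zero_lt_one.trans_le (one_le_sqrt_symb ξ))
    (sqrt_symb_le ξ)

/-- The solution of `(ξ² + wp + 1) ϑ - η c = h`. -/
noncomputable def freqSol (P : Data) (h : ℝ → ℂ) (c : ℂ) (ξ : ℝ) : ℂ :=
  (h ξ + (P.η ξ : ℂ) * c) / (P.symb ξ : ℂ)

section FreqSol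

variable {h : ℝ → ℂ}

lemma aestronglyMeasurable_freqSol (hh : MemLp h 2) (c : ℂ) : AEStronglyMeasurable (P.freqSol h c) volume := by
  have h1 : AEMeasurable (fun ξ => (P.η ξ : ℂ)) := (Complex.measurable_ofReal.comp
    measurable_η).aemeasurable
  have h2 : AEMeasurable (fun ξ => (P.symb ξ : ℂ)) := (Complex.measurable_ofReal.comp
    measurable_symb).aemeasurable
  exact ((hh.1.aemeasurable.add (h1.mul_const c)).div h2).aestronglyMeasurable

lemma memLp_bound (hh : MemLp h 2) (c : ℂ) : MemLp (fun ξ => ‖h ξ‖ + P.kernel ξ * ‖c‖) 2 :=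
  hh.norm.add (memLp_kernel.mul_const _)

/-- Division by the symbol can absorb a weight up to its square root and still leave the `L²`
function `kernel`. The weights `1` and `|ξ|` yield `ϑ ∈ L²` and `|ξ| ϑ ∈ L²`. -/
lemma mul_norm_freqSol_le (c : ℂ) {s : ℝ} (hs : 0 ≤ s) {ξ : ℝ} (hξ : s ≤ √(P.symb ξ)) :
    s * ‖P.freqSol h c ξ‖ ≤ ‖h ξ‖ + P.kernel ξ * ‖c‖ := by
  have hd := symb_pos (P := P) ξ
  have hsd := one_le_sqrt_symb (P := P) ξ
  have h1 : ‖P.freqSol h c ξ‖ ≤ (‖h ξ‖ + P.η ξ * ‖c‖) / P.symb ξ := by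
    rw [freqSol, norm_div, Complex.norm_real, Real.norm_of_nonneg hd.le]
    gcongr
    refine (norm_add_le _ _).trans ?_
    rw [norm_mul, Complex.norm_real, Real.norm_of_nonneg (η_nonneg ξ)]
  have h2 : s * ((‖h ξ‖ + P.η ξ * ‖c‖) / P.symb ξ) ≤
      √(P.symb ξ) * ((‖h ξ‖ + P.η ξ * ‖c‖) / P.symb ξ) := by
    have := η_nonneg (P := P) ξ
    gcongr
  have h3 : √(P.symb ξ) * ((‖h ξ‖ + P.η ξ * ‖c‖) / P.symb ξ) =
      ‖h ξ‖ / √(P.symb ξ) + P.kernel ξ * ‖c‖ := by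
    have h4 : P.symb ξ = √(P.symb ξ) * √(P.symb ξ) := (Real.mul_self_sqrt hd.le).symm
    have h5 : √(P.symb ξ) ≠ 0 := by positivity
    rw [kernel]
    nth_rw 2 [h4]
    field_simp
  have h6 : ‖h ξ‖ / √(P.symb ξ) ≤ ‖h ξ‖ := div_le_self (norm_nonneg _) hsd
  calc _ ≤ _ := mul_le_mul_of_nonneg_left h1 hs
    _ ≤ _ := by linarith

lemma memLp_freqSol (hh : MemLp h 2) (c : ℂ) : MemLp (P.freqSol h c) 2 := by
  refine (memLp_bound (P := P) hh c).of_le (aestronglyMeasurable_freqSol hh c)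
    (Eventually.of_forall fun ξ => ?_)
  have := mul_norm_freqSol_le (P := P) (h := h) c zero_le_one (one_le_sqrt_symb ξ)
  rw [one_mul] at this
  exact this.trans (le_abs_self _)

lemma memLp_abs_mul_freqSol (hh : MemLp h 2) (c : ℂ) : MemLp (fun ξ => ((|ξ| : ℝ) : ℂ) * P.freqSol h c ξ) 2 := by
  refine (memLp_bound (P := P) hh c).of_le ?_ (Eventually.of_forall fun ξ => ?_)
  · refine AEStronglyMeasurable.mul ?_ (aestronglyMeasurable_freqSol hh c)
    exact (by fun_prop : Continuous fun ξ : ℝ => ((|ξ| : ℝ) : ℂ)).aestronglyMeasurable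
  · have := mul_norm_freqSol_le (P := P) (h := h) c (abs_nonneg ξ) (abs_le_sqrt_symb ξ)
    rw [norm_mul, Complex.norm_real, Real.norm_of_nonneg (abs_nonneg ξ)]
    exact this.trans (le_abs_self _)

lemma integrable_η_mul_div (hh : MemLp h 2) : Integrable fun ξ => (P.η ξ : ℂ) * h ξ / (P.symb ξ : ℂ) := by
  have h1 : Integrable fun ξ => P.kernel ξ * ‖h ξ‖ := memLp_kernel.integrable_mul hh.norm
  refine h1.mono' ?_ (Eventually.of_forall fun ξ => ?_)
  · have h1 : AEMeasurable (fun ξ => (P.η ξ : ℂ)) := (Complex.measurable_ofReal.comp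
      measurable_η).aemeasurable
    have h2 : AEMeasurable (fun ξ => (P.symb ξ : ℂ)) := (Complex.measurable_ofReal.comp
      measurable_symb).aemeasurable
    exact ((h1.mul hh.1.aemeasurable).div h2).aestronglyMeasurable
  · rw [norm_div, norm_mul, Complex.norm_real, Complex.norm_real,
      Real.norm_of_nonneg (η_nonneg ξ), Real.norm_of_nonneg (symb_pos ξ).le, mul_div_right_comm]
    exact mul_le_mul_of_nonneg_right (η_div_symb_le ξ) (norm_nonneg _)

lemma η_mul_freqSol (c : ℂ) (ξ : ℝ) : (P.η ξ : ℂ) * P.freqSol h c ξ =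
    (P.η ξ : ℂ) * h ξ / (P.symb ξ : ℂ) + ((P.η ξ ^ 2 / P.symb ξ : ℝ) : ℂ) * c := by
  rw [freqSol]
  push_cast
  ring

lemma integrable_η_sq_div_symb_complex :
    Integrable fun ξ => ((P.η ξ ^ 2 / P.symb ξ : ℝ) : ℂ) := integrable_η_sq_div_symb.ofReal

lemma integrable_η_mul_freqSol (hh : MemLp h 2) (c : ℂ) : Integrable fun ξ => (P.η ξ : ℂ) * P.freqSol h c ξ := by
  simp_rw [η_mul_freqSol]
  exact (integrable_η_mul_div hh).add (integrable_η_sq_div_symb_complex.mul_const c)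

lemma integral_η_mul_freqSol (hh : MemLp h 2) (c : ℂ) : ∫ ξ, (P.η ξ : ℂ) * P.freqSol h c ξ =
    (∫ ξ, (P.η ξ : ℂ) * h ξ / (P.symb ξ : ℂ)) + (∫ ξ, P.η ξ ^ 2 / P.symb ξ : ℝ) * c := by
  simp_rw [η_mul_freqSol]
  rw [integral_add (integrable_η_mul_div hh) (integrable_η_sq_div_symb_complex.mul_const c),
    integral_mul_const, integral_complex_ofReal]

/-- The equation rearranged so that its right side is visibly in `L²`; for `c ≠ 0` the summand `η c`
alone is not. -/
lemma neg_symb_mul_freqSol (c : ℂ) (ξ : ℝ) :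
    -((ξ ^ 2 + P.wp : ℝ) : ℂ) * P.freqSol h c ξ + (P.η ξ : ℂ) * c = P.freqSol h c ξ - h ξ := by
  have h1 : (P.symb ξ : ℂ) * P.freqSol h c ξ = h ξ + (P.η ξ : ℂ) * c := by
    rw [freqSol, mul_div_cancel₀ _ (by exact_mod_cast (symb_pos (P := P) ξ).ne')]
  have h2 : (P.symb ξ : ℂ) = ((ξ ^ 2 + P.wp : ℝ) : ℂ) + 1 := by
    unfold symb
    push_cast
    ring
  rw [h2] at h1
  linear_combination -h1

end FreqSol

/-- Makes the coefficient of `ψ(1)` in the boundary condition nonzero, so that the strongly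
degenerate case can be solved for `ψ(1)`. -/
lemma integral_η_sq_div_symb_pos : 0 < ∫ ξ, P.η ξ ^ 2 / P.symb ξ := by
  have h0 : 0 ≤ fun ξ => P.η ξ ^ 2 / P.symb ξ := fun ξ =>
    div_nonneg (sq_nonneg _) (symb_pos ξ).le
  rw [integral_pos_iff_support_of_nonneg h0 integrable_η_sq_div_symb]
  refine lt_of_lt_of_le ?_ (measure_mono (s := Ioo (0 : ℝ) 1) fun ξ hξ => ?_)
  · simp
  · have h1 : 0 < P.η ξ := Real.rpow_pos_of_pos (abs_pos.2 hξ.1.ne') _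
    exact (div_pos (pow_pos h1 2) (symb_pos ξ)).ne'

end Data

/-! ### The boundary value problem in the space variable -/

lemma memH1_primitive {g : ℝ → ℂ} (hg : MemLp g 2 volI) (c : ℂ) :
    MemH1 (fun x => c + ∫ y in (0 : ℝ)..x, g y) ∧
      deriv (fun x => c + ∫ y in (0 : ℝ)..x, g y) =ᵐ[volI] g := by
  have hi : IntervalIntegrable g volume 0 1 := by
    rw [intervalIntegrable_iff_integrableOn_Ioo_of_le zero_le_one]
    exact hg.integrable (by norm_num)
  have hd : deriv (fun x => c + ∫ y in (0 : ℝ)..x, g y) =ᵐ[volI] g := by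
    rw [EventuallyEq, ae_restrict_iff' measurableSet_Ioo]
    filter_upwards [hi.ae_hasDerivAt_integral] with x hx hx'
    refine ((hx ?_ 0 (by simp)).const_add c).deriv
    rw [uIcc_of_le zero_le_one]
    exact Ioo_subset_Icc_self hx'
  refine ⟨⟨?_, hg.ae_eq hd.symm⟩, hd⟩
  exact (absolutelyContinuousOnInterval_const c 0 1).add
    (absolutelyContinuousOnInterval_integral hi (by simp))

lemma intervalIntegrable_of_continuousOn_Ioc {w : ℝ → ℂ} (hw : ContinuousOn w (Ioc 0 1)) {a b : ℝ}
    (ha : a ∈ Ioc (0 : ℝ) 1) (hb : b ∈ Ioc (0 : ℝ) 1) : IntervalIntegrable w volume a b :=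
  (hw.mono ((convex_Ioc (0 : ℝ) 1).ordConnected.uIcc_subset ha hb)).intervalIntegrable

lemma hasDerivAt_primitive_Ioc {w : ℝ → ℂ} (hw : ContinuousOn w (Ioc 0 1)) (c : ℂ) {x : ℝ}
    (hx : x ∈ Ioo (0 : ℝ) 1) : HasDerivAt (fun x => c + ∫ y in (1 : ℝ)..x, w y) (w x) x := by
  refine HasDerivAt.const_add c (intervalIntegral.integral_hasDerivAt_right
    (intervalIntegrable_of_continuousOn_Ioc hw ⟨one_pos, le_rfl⟩ (Ioo_subset_Ioc_self hx)) ?_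
    (hw.continuousAt (Ioc_mem_nhds hx.1 hx.2)))
  exact (hw.mono Ioo_subset_Ioc_self).stronglyMeasurableAtFilter isOpen_Ioo x hx

lemma locAC_primitive {w : ℝ → ℂ} (hw : ContinuousOn w (Ioc 0 1)) (c : ℂ) :
    LocAC fun x => c + ∫ y in (1 : ℝ)..x, w y := fun δ hδ =>
  (absolutelyContinuousOnInterval_const c δ 1).add
    (absolutelyContinuousOnInterval_integral (intervalIntegrable_of_continuousOn_Ioc hw
      ⟨hδ.1, hδ.2.le⟩ ⟨one_pos, le_rfl⟩) (by simp))

lemma integrableOn_rpow_Ioo {r : ℝ} (hr : -1 < r) : IntegrableOn (fun x : ℝ => x ^ r) (Ioo 0 1) := by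
  rw [← intervalIntegrable_iff_integrableOn_Ioo_of_le zero_le_one]
  exact intervalIntegral.intervalIntegrable_rpow' hr

/-- The primitive grows at most like `x^{p+1}`, and `2 (p + 1) > -1`. -/
lemma memLp_primitive {w : ℝ → ℂ} (hw : ContinuousOn w (Ioc 0 1)) (c : ℂ) {M p : ℝ} (hM : 0 ≤ M)
    (hp : -(3 / 2) < p) (h : ∀ x ∈ Ioc (0 : ℝ) 1, ‖w x‖ ≤ M * x ^ p) :
    MemLp (fun x => c + ∫ y in (1 : ℝ)..x, w y) 2 volI := by
  -- Lowering the exponent weakens the bound on `(0, 1]` and avoids the logarithm at `p = -1`;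
  -- `-5/4` lies between `-3/2` and `-1`.
  wlog hp' : p < -1 generalizing p
  · refine this (p := -(5 / 4)) (by norm_num) (fun x hx => (h x hx).trans ?_) (by norm_num)
    exact mul_le_mul_of_nonneg_left
      (Real.rpow_le_rpow_of_exponent_ge hx.1 hx.2 (by linarith)) hM
  have hm : AEStronglyMeasurable (fun x => c + ∫ y in (1 : ℝ)..x, w y) volI :=
    ((locAC_primitive hw c).continuousOn.mono Ioo_subset_Ioc_self).aestronglyMeasurable
      measurableSet_Ioo
  rw [memLp_two_iff_integrable_sq_norm hm]
  have hdom : IntegrableOn (fun x : ℝ => 2 * ‖c‖ ^ 2 + 2 * (M / (-(p + 1))) ^ 2 * x ^ (2 * (p + 1)))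
      (Ioo 0 1) :=
    (integrable_const _).add ((integrableOn_rpow_Ioo (by linarith)).const_mul _)
  refine Integrable.mono' hdom (hm.norm.pow 2) ?_
  filter_upwards [ae_restrict_mem measurableSet_Ioo] with x hx
  have hpos : 0 < -(p + 1) := by linarith
  have h1 : ‖∫ y in (1 : ℝ)..x, w y‖ ≤ M / (-(p + 1)) * x ^ (p + 1) := by
    have h0 : (0 : ℝ) ∉ uIcc x 1 := by
      rw [uIcc_of_le hx.2.le]
      exact fun h => absurd h.1 (not_le.2 hx.1)
    rw [intervalIntegral.integral_symm, norm_neg]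
    calc _ ≤ ∫ y in x..1, M * y ^ p := by
          refine intervalIntegral.norm_integral_le_of_norm_le hx.2.le
            (Eventually.of_forall fun y hy => h y ⟨hx.1.trans hy.1, hy.2⟩) ?_
          exact (intervalIntegral.intervalIntegrable_rpow (Or.inr h0)).const_mul _
      _ = M * ((1 - x ^ (p + 1)) / (p + 1)) := by
          rw [intervalIntegral.integral_const_mul, integral_rpow (Or.inr ⟨hp'.ne, h0⟩),
            Real.one_rpow]
      _ = M / (-(p + 1)) * (x ^ (p + 1) - 1) := by
          have : p + 1 ≠ 0 := by linarith
          field_simp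
          ring
      _ ≤ _ := by gcongr; linarith
  have h2 : ‖c + ∫ y in (1 : ℝ)..x, w y‖ ≤ ‖c‖ + M / (-(p + 1)) * x ^ (p + 1) :=
    (norm_add_le _ _).trans (by gcongr)
  have h3 : x ^ (2 * (p + 1)) = (x ^ (p + 1)) ^ 2 := by
    rw [mul_comm, Real.rpow_mul hx.1.le]
    norm_cast
  rw [Real.norm_of_nonneg (by positivity), h3]
  calc _ ≤ (‖c‖ + M / (-(p + 1)) * x ^ (p + 1)) ^ 2 := by gcongr
    _ ≤ _ := by nlinarith [sq_nonneg (‖c‖ - M / (-(p + 1)) * x ^ (p + 1))]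

namespace Data

variable {P : Data}

lemma continuousOn_flux_div {v : ℝ → ℂ} (hv : ContinuousOn v (Icc 0 1)) :
    ContinuousOn (fun x => v x / (P.τ x : ℂ)) (Ioc 0 1) := by
  refine (hv.mono Ioc_subset_Icc_self).div ?_ fun x hx => ?_
  · exact Complex.continuous_ofReal.comp_continuousOn
      (P.continuousOn_τ.mono Ioc_subset_Icc_self)
  · exact_mod_cast (P.τ_pos x hx).ne'

lemma norm_flux_div_le {v : ℝ → ℂ} {M s : ℝ}
    (h : ∀ x ∈ Ioc (0 : ℝ) 1, ‖v x‖ ≤ M * x ^ s) {x : ℝ} (hx : x ∈ Ioc (0 : ℝ) 1) :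
    ‖v x / (P.τ x : ℂ)‖ ≤ M / P.τ 1 * x ^ (s - P.m) := by
  have h1 := P.mul_rpow_le_τ hx
  have h2 : 0 < x ^ P.m := Real.rpow_pos_of_pos hx.1 _
  have h3 := P.τ_one_pos
  have h4 := h x hx
  rw [norm_div, Complex.norm_real, Real.norm_of_nonneg (P.τ_pos x hx).le, Real.rpow_sub hx.1,
    div_mul_div_comm]
  gcongr
  exact (norm_nonneg _).trans h4

/-- Solve `f' = v / τ` from the nondegenerate end, with `f(1) = c`. Since `τ ≥ τ(1) x^m`, the energy
density `|v|² / τ` is `O(x^{2s-m})` and `f'` is `O(x^{s-m})`. The exponent `s = 0` serves for `m <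
1`, and `s = 1/2`, which requires `v(0) = 0`, for `m < 2`. -/
lemma memH2τ_primitive {v : ℝ → ℂ} (hv : MemH1 v) (c : ℂ) {M s : ℝ}
    (h : ∀ x ∈ Ioc (0 : ℝ) 1, ‖v x‖ ≤ M * x ^ s) (h1 : -1 < 2 * s - P.m)
    (h2 : -(3 / 2) < s - P.m) :
    MemH2τ P.τ (fun x => c + ∫ y in (1 : ℝ)..x, v y / (P.τ y : ℂ)) v := by
  have hM : 0 ≤ M := by
    have := (norm_nonneg _).trans (h 1 ⟨one_pos, le_rfl⟩)
    simpa using this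
  have hw := continuousOn_flux_div (P := P) hv.continuousOn
  have hder : ∀ x ∈ Ioo (0 : ℝ) 1,
      deriv (fun x => c + ∫ y in (1 : ℝ)..x, v y / (P.τ y : ℂ)) x = v x / (P.τ x : ℂ) :=
    fun x hx => (hasDerivAt_primitive_Ioc hw c hx).deriv
  refine ⟨⟨memLp_primitive hw c (div_nonneg hM P.τ_one_pos.le) h2
    (fun x hx => norm_flux_div_le h hx), locAC_primitive hw c, ?_⟩, hv, ?_⟩
  · have hcont : ContinuousOn (fun x => (√(P.τ x) : ℂ) * (v x / (P.τ x : ℂ))) (Ioo 0 1) := by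
      refine ContinuousOn.mul ?_ (hw.mono Ioo_subset_Ioc_self)
      exact Complex.continuous_ofReal.comp_continuousOn
        (P.continuousOn_τ.mono Ioo_subset_Icc_self).sqrt
    have hm : AEStronglyMeasurable (fun x => (√(P.τ x) : ℂ) * (v x / (P.τ x : ℂ))) volI :=
      hcont.aestronglyMeasurable measurableSet_Ioo
    refine MemLp.ae_eq (f := fun x => (√(P.τ x) : ℂ) * (v x / (P.τ x : ℂ))) ?_ ?_
    · filter_upwards [ae_restrict_mem measurableSet_Ioo] with x hx
      rw [hder x hx]
    · rw [memLp_two_iff_integrable_sq_norm hm]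
      refine Integrable.mono' ((integrableOn_rpow_Ioo h1).const_mul (M * (M / P.τ 1)))
        (hm.norm.pow 2) ?_
      filter_upwards [ae_restrict_mem measurableSet_Ioo] with x hx
      have hx' := Ioo_subset_Ioc_self hx
      have hτ := P.τ_pos x hx'
      have e : ‖(√(P.τ x) : ℂ) * (v x / (P.τ x : ℂ))‖ ^ 2 = ‖v x‖ * ‖v x / (P.τ x : ℂ)‖ := by
        rw [norm_mul, norm_div, mul_pow, div_pow, Complex.norm_real, Complex.norm_real,
          Real.norm_of_nonneg hτ.le, Real.norm_of_nonneg (Real.sqrt_nonneg _),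
          Real.sq_sqrt hτ.le]
        field_simp
      rw [Real.norm_of_nonneg (by positivity), e]
      have e2 : x ^ (2 * s - P.m) = x ^ s * x ^ (s - P.m) := by
        rw [← Real.rpow_add hx.1]; congr 1; ring
      calc _ ≤ M * x ^ s * (M / P.τ 1 * x ^ (s - P.m)) :=
            mul_le_mul (h x hx') (norm_flux_div_le h hx') (norm_nonneg _)
              (mul_nonneg hM (Real.rpow_nonneg hx.1.le _))
        _ = _ := by rw [e2]; ring
  · filter_upwards [ae_restrict_mem measurableSet_Ioo] with x hx
    have : (P.τ x : ℂ) ≠ 0 := by exact_mod_cast (P.τ_pos x (Ioo_subset_Ioc_self hx)).ne'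
    rw [hder x hx, mul_div_cancel₀ _ this]

/-- Weakly degenerate case. -/
lemma exists_spaceSol_of_lt (hm : degIndex P.τ < 1) {g : ℝ → ℂ} (hg : MemLp g 2 volI) (C : ℝ)
    (D : ℂ) : ∃ f v : ℝ → ℂ, MemH2τ P.τ f v ∧ MemW1 P.τ f ∧
      v 1 = Complex.I * (D + C * f 1) ∧ deriv v =ᵐ[volI] g := by
  have hm' := P.m_lt_one_iff.2 hm
  obtain ⟨M, hM, hMg⟩ := exists_norm_integral_le_sqrt hg
  set G : ℝ → ℂ := fun x => ∫ y in (0 : ℝ)..x, g y with hG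
  have hbound : ∀ (c₀ : ℂ), ∀ x ∈ Ioc (0 : ℝ) 1, ‖c₀ + G x‖ ≤ (‖c₀‖ + M) * x ^ (0 : ℝ) := by
    intro c₀ x hx
    rw [Real.rpow_zero, mul_one]
    refine (norm_add_le _ _).trans ?_
    have : √x ≤ 1 := Real.sqrt_le_one.2 hx.2
    have := hMg x hx
    nlinarith
  have hint : ∀ c₀ : ℂ, IntegrableOn (fun x => (c₀ + G x) / (P.τ x : ℂ)) (Ioo 0 1) := by
    intro c₀
    have hw := continuousOn_flux_div (P := P) (memH1_primitive hg c₀).1.continuousOn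
    refine Integrable.mono' ((integrableOn_rpow_Ioo (r := 0 - P.m) (by linarith)).const_mul
      ((‖c₀‖ + M) / P.τ 1))
      ((hw.mono Ioo_subset_Ioc_self).aestronglyMeasurable measurableSet_Ioo) ?_
    filter_upwards [ae_restrict_mem measurableSet_Ioo] with x hx
    exact norm_flux_div_le (hbound c₀) (Ioo_subset_Ioc_self hx)
  set N : ℂ := ∫ x in Ioo (0 : ℝ) 1, G x / (P.τ x : ℂ) with hN
  set J : ℝ := ∫ x in Ioo (0 : ℝ) 1, (P.τ x)⁻¹ with hJ
  have hGi : IntegrableOn (fun x => G x / (P.τ x : ℂ)) (Ioo 0 1) := by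
    simpa using hint 0
  have hτi : IntegrableOn (fun x => (((P.τ x)⁻¹ : ℝ) : ℂ)) (Ioo 0 1) := by
    refine ((hint 1).sub hGi).congr (Eventually.of_forall fun x => ?_)
    simp only [Pi.sub_apply]
    push_cast
    ring
  have hsplit : ∀ c₀ : ℂ, ∫ x in Ioo (0 : ℝ) 1, (c₀ + G x) / (P.τ x : ℂ) = c₀ * J + N := by
    intro c₀
    rw [hJ, hN, ← integral_complex_ofReal, ← integral_const_mul, ← integral_add (hτi.const_mul _) hGi]
    refine integral_congr_ae (Eventually.of_forall fun x => ?_)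
    simp only
    push_cast
    ring
  -- Its real part is `1`, because `C` and `J` are real.
  have hne : (1 - Complex.I * C * J : ℂ) ≠ 0 := by
    intro h
    have := congrArg Complex.re h
    simp at this
  -- The unknowns are `c₀ = v(0)` and `c = f(1)`. The condition `f(0) = 0` means `c = c₀ J + N`, and
  -- the condition at `1` is then `c₀ + G(1) = i (D + C c)`, linear in `c₀`.
  set c₀ : ℂ := (Complex.I * D + Complex.I * C * N - G 1) / (1 - Complex.I * C * J) with hc₀
  set c : ℂ := c₀ * J + N with hc
  have h2 := memH2τ_primitive (P := P) (memH1_primitive hg c₀).1 c (hbound c₀)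
    (by linarith) (by linarith)
  refine ⟨_, _, h2, ⟨h2.1, fun _ => ?_⟩, ?_, (memH1_primitive hg c₀).2⟩
  · have hcont := intervalIntegral.continuousOn_primitive_interval_left
      (f := fun x => (c₀ + G x) / (P.τ x : ℂ)) (a := 0) (b := 1) (μ := volume) (by
        rw [uIcc_of_le zero_le_one, integrableOn_Icc_iff_integrableOn_Ioo]
        exact hint c₀)
    rw [uIcc_of_le zero_le_one] at hcont
    have h3 := (hcont 0 ⟨le_rfl, zero_le_one⟩).mono_left
      (nhdsWithin_le_of_mem (Icc_mem_nhdsGT zero_lt_one))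
    have h4 := h3.const_sub c
    have h5 : ∫ x in (0 : ℝ)..1, (c₀ + G x) / (P.τ x : ℂ) = c := by
      rw [intervalIntegral.integral_of_le zero_le_one, integral_Ioc_eq_integral_Ioo, hsplit]
    beta_reduce at h4
    rw [h5, sub_self] at h4
    refine h4.congr fun x => ?_
    rw [intervalIntegral.integral_symm, sub_neg_eq_add]
  · simp only [intervalIntegral.integral_same, add_zero]
    have h6 : c₀ * (1 - Complex.I * C * J) = Complex.I * D + Complex.I * C * N - G 1 := by
      rw [hc₀, div_mul_cancel₀ _ hne]
    change c₀ + G 1 = _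
    rw [hc]
    linear_combination h6

/-- Strongly degenerate case. -/
lemma exists_spaceSol_of_not_lt (hm : ¬ degIndex P.τ < 1) {g : ℝ → ℂ} (hg : MemLp g 2 volI)
    {C : ℝ} (hC : C ≠ 0) (D : ℂ) : ∃ f v : ℝ → ℂ, MemH2τ P.τ f v ∧ MemW1 P.τ f ∧
      v 1 = Complex.I * (D + C * f 1) ∧ deriv v =ᵐ[volI] g := by
  have hm2 := P.m_lt_two
  obtain ⟨M, hM, hMg⟩ := exists_norm_integral_le_sqrt hg
  set G : ℝ → ℂ := fun x => ∫ y in (0 : ℝ)..x, g y with hG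
  have hbound : ∀ x ∈ Ioc (0 : ℝ) 1, ‖0 + G x‖ ≤ M * x ^ (1 / 2 : ℝ) := by
    intro x hx
    rw [zero_add, ← Real.sqrt_eq_rpow]
    exact hMg x hx
  -- Here `v(0) = 0` is imposed, as `flux_zero` requires, so `f(1) = c` is the only free constant;
  -- it is determined by `G(1) = i (D + C c)`.
  set c : ℂ := (-Complex.I * G 1 - D) / C
  have h2 := memH2τ_primitive (P := P) (memH1_primitive hg 0).1 c hbound
    (by linarith) (by linarith)
  refine ⟨_, _, h2, ⟨h2.1, fun h => absurd h hm⟩, ?_, (memH1_primitive hg 0).2⟩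
  have hC' : (C : ℂ) ≠ 0 := by exact_mod_cast hC
  simp only [intervalIntegral.integral_same, add_zero, c, mul_div_cancel₀ _ hC']
  change 0 + G 1 = _
  linear_combination G 1 * Complex.I_sq

lemma exists_spaceSol {g : ℝ → ℂ} (hg : MemLp g 2 volI) {C : ℝ} (hC : C ≠ 0) (D : ℂ) :
    ∃ f v : ℝ → ℂ, MemH2τ P.τ f v ∧ MemW1 P.τ f ∧
      v 1 = Complex.I * (D + C * f 1) ∧ deriv v =ᵐ[volI] g := by
  by_cases hm : degIndex P.τ < 1
  · exact exists_spaceSol_of_lt hm hg C D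
  · exact exists_spaceSol_of_not_lt hm hg hC D

end Data

namespace Data

variable {P : Data}

/-! ### Maximality -/

variable (P) in
/-- The orthogonal projection `(ψ, ϑ) ↦ (ψ, 0)` of the state space. -/
noncomputable def projPsi : P.H →L[ℂ] P.H :=
  (WithLp.prodContinuousLinearEquiv 2 ℂ (Lp ℂ 2 volI) (Lp ℂ 2 P.volζ)).symm.toContinuousLinearMap ∘L
    ((ContinuousLinearMap.fst ℂ (Lp ℂ 2 volI) (Lp ℂ 2 P.volζ)).prod 0) ∘L
    (WithLp.prodContinuousLinearEquiv 2 ℂ (Lp ℂ 2 volI) (Lp ℂ 2 P.volζ)).toContinuousLinearMap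

lemma projPsi_apply (U : P.H) : P.projPsi U = WithLp.toLp 2 (U.fst, 0) := rfl

lemma projPsi_idem (U : P.H) : P.projPsi (P.projPsi U) = P.projPsi U := rfl

lemma inner_projPsi_left (U V : P.H) : inner ℂ (P.projPsi U) V = inner ℂ U (P.projPsi V) := by
  simp [WithLp.prod_inner_apply, projPsi_apply]

lemma inner_sub_projPsi_nonneg (U : P.H) : 0 ≤ (inner ℂ U (U - P.projPsi U)).re := by
  have e : inner ℂ U (U - P.projPsi U) = inner ℂ U.snd U.snd := by
    rw [WithLp.prod_inner_apply]
    change inner ℂ U.fst (U.fst - U.fst) + inner ℂ U.snd (U.snd - 0) = _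
    rw [sub_self, inner_zero_right, zero_add, sub_zero]
  rw [e, inner_self_eq_norm_sq_to_K]
  simp only [Complex.coe_algebraMap, ← Complex.ofReal_pow, Complex.ofReal_re]
  positivity

/-- The equation `(0, ϑ) - 𝒜 (ψ, ϑ) = F` is solvable. -/
lemma exists_isGen_sub_projPsi (F : P.H) : ∃ U : P.H, IsGen U (U - P.projPsi U - F) := by
  have hh := memLp_theta F
  -- Substituting `ϑ = (h + η ψ(1)) / (ξ² + wp + 1)`, with `h` the second component of `F`, turns `ζ
  -- ∫ η ϑ` into `D + C ψ(1)`: the frequency variable is eliminated.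
  set C : ℝ := P.ζ * ∫ ξ, P.η ξ ^ 2 / P.symb ξ with hC
  have hC0 : C ≠ 0 := (mul_pos P.ζ_pos integral_η_sq_div_symb_pos).ne'
  set D : ℂ := P.ζ * ∫ ξ, (P.η ξ : ℂ) * theta F ξ / (P.symb ξ : ℂ) with hD
  obtain ⟨f, v, h2, hW, hv1, hv⟩ :=
    exists_spaceSol (P := P) ((Lp.memLp F.fst).const_mul Complex.I) hC0 D
  have hθ := memLp_freqSol (P := P) hh (f 1)
  have hθ' : MemLp (P.freqSol (theta F) (f 1)) 2 P.volζ := hθ.smul_measure ENNReal.ofReal_ne_top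
  set U : P.H := WithLp.toLp 2 (h2.1.1.toLp f, hθ'.toLp _) with hU
  have hψU : psi U =ᵐ[volI] f := h2.1.1.coeFn_toLp
  have hθU : theta U =ᵐ[volume] P.freqSol (theta F) (f 1) := P.ae_of_ae_volζ hθ'.coeFn_toLp
  have e1 : (fun ξ => (P.η ξ : ℂ) * theta U ξ) =ᵐ[volume]
      fun ξ => (P.η ξ : ℂ) * P.freqSol (theta F) (f 1) ξ := by
    filter_upwards [hθU] with ξ h
    rw [h]
  have e2 : (fun ξ => -((ξ ^ 2 + P.wp : ℝ) : ℂ) * theta U ξ + (P.η ξ : ℂ) * f 1) =ᵐ[volume]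
      fun ξ => P.freqSol (theta F) (f 1) ξ - theta F ξ := by
    filter_upwards [hθU] with ξ h
    rw [h, neg_symb_mul_freqSol]
  refine ⟨U, f, v, ⟨hψU, h2, hW, ?_, ?_, ?_, ?_⟩, ?_, ?_⟩
  · exact (integrable_η_mul_freqSol hh (f 1)).congr e1.symm
  · rw [integral_congr_ae e1, integral_η_mul_freqSol hh, hv1, hC, hD]
    push_cast
    ring
  · exact (hθ.sub hh).ae_eq e2.symm
  · refine (memLp_abs_mul_freqSol (P := P) hh (f 1)).ae_eq ?_
    filter_upwards [hθU] with ξ h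
    rw [h]
  · have e3 : (U - P.projPsi U - F).fst = -F.fst := by
      simp [projPsi_apply]
    have e4 : psi (U - P.projPsi U - F) =ᵐ[volI] -psi F := by
      unfold psi
      rw [e3]
      exact Lp.coeFn_neg _
    filter_upwards [e4, hv] with x h1 h2
    rw [h1, h2, ← mul_assoc, Complex.I_mul_I, neg_one_mul]
    rfl
  · have e3 : (U - P.projPsi U - F).snd = U.snd - F.snd := by
      simp [projPsi_apply]
    have e4 : theta (U - P.projPsi U - F) =ᵐ[volume] theta U - theta F := by
      unfold theta
      rw [e3]
      exact P.ae_of_ae_volζ (Lp.coeFn_sub _ _)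
    filter_upwards [e4, e2, hθU] with ξ h1 h2 h3
    rw [h1, h2, Pi.sub_apply, h3]

lemma isGen_A (x : P.A.domain) : IsGen (x : P.H) (P.A x) :=
  mem_graph_A.1 (P.A.mem_graph x)

lemma A_dissipative (x : P.A.domain) : (inner ℂ (x : P.H) (P.A x)).re ≤ 0 :=
  (isGen_A x).re_inner_nonpos

/-- Deleting the zero-order term `ψ` from the first equation leaves `T = 1 - Q - 𝒜`, still accretive
and solvable by quadrature; the abstract perturbation result puts `Q` back. -/
lemma exists_sub_A_eq (F : P.H) : ∃ x : P.A.domain, (x : P.H) - P.A x = F := by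
  let T : P.A.domain →ₗ[ℂ] P.H :=
    (1 - P.projPsi).toLinearMap ∘ₗ P.A.domain.subtype - P.A.toFun
  have hT : ∀ x : P.A.domain, T x = (x : P.H) - P.projPsi x - P.A x := fun x => rfl
  have hacc : ∀ x : P.A.domain, 0 ≤ (inner ℂ (T x) (x : P.H)).re := fun x => by
    rw [hT, ← inner_conj_symm, Complex.conj_re, inner_sub_right, Complex.sub_re]
    linarith [inner_sub_projPsi_nonneg (x : P.H), A_dissipative x]
  have hsurj : Function.Surjective T := fun F => by
    obtain ⟨U, hU⟩ := exists_isGen_sub_projPsi F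
    obtain ⟨x, hx1, hx2⟩ := (P.A.mem_graph_iff).1 (mem_graph_A.2 hU)
    simp only at hx1 hx2
    refine ⟨x, ?_⟩
    rw [hT, hx2, hx1]
    abel
  obtain ⟨x, hx⟩ := exists_apply_add_projection_eq T hacc hsurj P.projPsi projPsi_idem
    inner_projPsi_left F
  refine ⟨x, ?_⟩
  rw [← hx, hT]
  abel

end Data

end DegSchrodinger

theorem theorem3p1 (P : DegSchrodinger.Data) (U₀ : P.H) :
    ∃ U : ℝ → P.H,
      DegSchrodinger.IsMildSolution P.A U₀ U ∧
      (∀ V : ℝ → P.H, DegSchrodinger.IsMildSolution P.A U₀ V → Set.EqOn V U (Set.Ici 0)) ∧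
      (U₀ ∈ P.A.domain →
        DegSchrodinger.ContinuousInDomain P.A U ∧
        DegSchrodinger.C1OnHalfLine U ∧
        DegSchrodinger.SolvesPointwise P.A U₀ U) :=
  DegSchrodinger.wellPosed_of_maximal_dissipative DegSchrodinger.Data.A_dissipative
    DegSchrodinger.Data.exists_sub_A_eq U₀
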